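/- **Theorem (arbitrary order robust tensor power method).** For a tensor $A\in\mathbb R^{n^p}$ (order $p$, all dimensions $n$) write $A(x_1,\dots,x_p)=\sum_{i_1,\dots,i_p}A_{i_1\cdots i_p}(x_1)_{i_1}\cdots(x_p)_{i_p}$, let $A(I,u,\dots,u)\in\mathbb R^n$ be the vector with coordinates $A(e_a,u,\dots,u)$, and let $\|A\|=\sup\{|A(x_1,\dots,x_p)| : \|x_1\|_2=\dots=\|x_p\|_2=1\}$. *Robust tensor power method with deflation, with parameters $k,L,T$.* For $r=1,\dots,k$: let $A_r=A-\sum_{i<r}\widehat\lambda_i\widehat v_i^{\otimes p}$; draw $L$ fresh starting vectors that are standard Gaussian in $\mathbb R^n$ (all $kL$ starting vectors are independent); from each of them run $T$ iterations of $u\leftarrow A_r(I,u,\dots,u)/\|A_r(I,u,\dots,u)\|_2$; select an end point $u$ with the largest value $A_r(u,\dots,u)$ (ties broken in any way); run $T$ further iterations from it; let $\widehat v_r$ be the resulting vector and $\widehat\lambda_r=A_r(\widehat v_r,\dots,\widehat v_r)$. The output is $\{(\widehat\lambda_i,\widehat v_i)\}_{i=1}^k$. There are absolute constants $c,C_T,C_L>0$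 such that the following holds. Let $p\ge 3$ and $n\ge k\ge 1$, let $v_1,\dots,v_k\in\mathbb R^n$ be orthonormal, let $\lambda_1,\dots,\lambda_k>0$ with $\lambda_{\max}=\max_i\lambda_i$ and $\lambda_{\min}=\min_i\lambda_i$, let $c_0\ge 100$, and let $$0<\epsilon<\frac{c\,\lambda_{\min}}{c_0\,p^2\,k\,n^{(p-2)/2}} .$$ Let $A=A^*+E\in\mathbb R^{n^p}$ with $A^*=\sum_{i=1}^k\lambda_i v_i^{\otimes p}$ and $\|E\|\le\epsilon/(c_0\sqrt n)$, and let $T,L\in\mathbb N$ satisfy $$T\ge C_T\log(\lambda_{\max}n/\epsilon),\qquad L\ge C_L\,k\log(k+1).$$ Then, with probability at least $9/10$ over the starting vectors, the output on input $A$ has the following property: there is a permutation $\pi$ of $\{1,\dots,k\}$ such that for every $i$ $$|\lambda_i-\widehat\lambda_{\pi(i)}|\le\epsilon\qquad\text{and}\qquad \|v_i-\widehat v_{\pi(i)}\|_2\le\epsilon/\lambda_i ,$$ where, if $p$ is even, the second inequality is understood up to the sign of $v_i$, that is, $\min\big(\|v_i-\widehat v_{\pi(i)}\|_2,\|v_i+\widehat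 v_{\pi(i)}\|_2\big)\le\epsilon/\lambda_i$. -/

import Mathlib

open MeasureTheory ProbabilityTheory

/-- A real tensor of order `p`, all of whose `p` modes have dimension `n`. -/
abbrev PTensor (p n : ℕ) : Type := (Fin p → Fin n) → ℝ

namespace PTensor

variable {p n k L : ℕ}

/-- `A(x₁, …, x_p) = ∑_{i₁, …, i_p} A_{i₁ … i_p} (x₁)_{i₁} ⋯ (x_p)_{i_p}`. -/
noncomputable def eval (A : PTensor p n) (x : Fin p → EuclideanSpace ℝ (Fin n)) : ℝ :=
  ∑ i : Fin p → Fin n, A i * ∏ j, x j (i j)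

/-- The vector `A(I, u, …, u)`: its `a`-th coordinate is `A(e_a, u, …, u)`, that is,
`∑_{i₂, …, i_p} A_{a i₂ … i_p} u_{i₂} ⋯ u_{i_p}`. -/
noncomputable def contract (A : PTensor p n) (u : EuclideanSpace ℝ (Fin n)) :
    EuclideanSpace ℝ (Fin n) :=
  WithLp.toLp 2 fun a =>
    eval A fun j => if (j : ℕ) = 0 then EuclideanSpace.single a (1 : ℝ) else u

/-- The rank-one tensor `v^{⊗ p}`. -/
def rankOne (p : ℕ) (v : EuclideanSpace ℝ (Fin n)) : PTensor p n :=
  fun i => ∏ j, v (i j)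

/-- The spectral norm `‖E‖ = sup |E(x₁, …, x_p)|` over unit vectors `x₁, …, x_p`. -/
noncomputable def spectralNorm (E : PTensor p n) : ℝ :=
  sSup {r : ℝ | ∃ x : Fin p → EuclideanSpace ℝ (Fin n), (∀ j, ‖x j‖ = 1) ∧ r = |eval E x|}

/-- One power iteration `u ↦ A(I, u, …, u) / ‖A(I, u, …, u)‖₂`. -/
noncomputable def powerStep (A : PTensor p n) (u : EuclideanSpace ℝ (Fin n)) :
    EuclideanSpace ℝ (Fin n) :=
  ‖contract A u‖⁻¹ • contract A u

/-- `T` power iterations started at `u`. -/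
noncomputable def powerIter (A : PTensor p n) (T : ℕ) (u : EuclideanSpace ℝ (Fin n)) :
    EuclideanSpace ℝ (Fin n) :=
  (powerStep A)^[T] u

/-- The estimated value `A(u, …, u)`. -/
noncomputable def value (A : PTensor p n) (u : EuclideanSpace ℝ (Fin n)) : ℝ :=
  eval A fun _ => u

/-- `(mu, w)` is what the robust tensor power method returns for the tensor `A`, with starting
vectors `start 1, …, start L`: run `T` power iterations from each starting vector, select an
end point with the largest value (ties may be broken in any way), run `T` further iterations
from it, and return the resulting vector with its value. -/
def IsPowerMethodOutput (A : PTensor p n) (start : Fin L → EuclideanSpace ℝ (Fin n)) (T : ℕ)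
    (mu : ℝ) (w : EuclideanSpace ℝ (Fin n)) : Prop :=
  ∃ l : Fin L,
    (∀ m : Fin L, value A (powerIter A T (start m)) ≤ value A (powerIter A T (start l))) ∧
    w = powerIter A T (powerIter A T (start l)) ∧ mu = value A w

/-- The tensor left after the first `r` recovered pairs have been subtracted,
`A - ∑_{i < r} mu_i w_i^{⊗ p}`. -/
noncomputable def deflate (A : PTensor p n) (mu : Fin k → ℝ)
    (w : Fin k → EuclideanSpace ℝ (Fin n)) (r : Fin k) : PTensor p n :=
  A - ∑ i ∈ Finset.Iio r, mu i • rankOne p (w i)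

/-- `(mu_r, w_r)`, for `r` in `Fin k`, are the pairs returned by `k` rounds of the robust tensor
power method with deflation; round `r` works on the deflated tensor and uses the starting
vectors `start r 1, …, start r L`. -/
def IsDeflationOutput (A : PTensor p n) (start : Fin k → Fin L → EuclideanSpace ℝ (Fin n))
    (T : ℕ) (mu : Fin k → ℝ) (w : Fin k → EuclideanSpace ℝ (Fin n)) : Prop :=
  ∀ r : Fin k, IsPowerMethodOutput (deflate A mu w r) (start r) T (mu r) (w r)

/-- With at least one starting vector per round the method always has an output. -/
theorem exists_isDeflationOutput (hL : 0 < L) (A : PTensor p n)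
    (start : Fin k → Fin L → EuclideanSpace ℝ (Fin n)) (T : ℕ) :
    ∃ mu w, IsDeflationOutput A start T mu w := by
  have : Nonempty (Fin L) := ⟨⟨0, hL⟩⟩
  have key : ∀ m : ℕ, m ≤ k → ∃ (mu : Fin k → ℝ) (w : Fin k → EuclideanSpace ℝ (Fin n)),
      ∀ r : Fin k, (r : ℕ) < m →
        IsPowerMethodOutput (deflate A mu w r) (start r) T (mu r) (w r) := by
    intro m
    induction m with
    | zero => exact fun _ => ⟨0, 0, fun r hr => absurd hr (Nat.not_lt_zero _)⟩
    | succ m ih =>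
      intro hm
      obtain ⟨mu, w, h⟩ := ih (by omega)
      let s : Fin k := ⟨m, hm⟩
      let B := deflate A mu w s
      obtain ⟨l, hl⟩ := Finite.exists_max fun m => value B (powerIter B T (start s m))
      let x := powerIter B T (powerIter B T (start s l))
      have hdef : ∀ r : Fin k, (r : ℕ) ≤ m →
          deflate A (Function.update mu s (value B x)) (Function.update w s x) r
            = deflate A mu w r := by
        intro r hr
        unfold deflate
        congr 1
        refine Finset.sum_congr rfl fun i hi => ?_
        have hi' : i < r := Finset.mem_Iio.mp hi
        have hne : i ≠ s := by
          rintro rfl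
          have : m < (r : ℕ) := hi'
          omega
        rw [Function.update_of_ne hne, Function.update_of_ne hne]
      refine ⟨Function.update mu s (value B x), Function.update w s x, fun r hr => ?_⟩
      rw [hdef r (by omega)]
      by_cases hrs : r = s
      · subst hrs
        simp only [Function.update_self]
        exact ⟨l, hl, rfl, rfl⟩
      · rw [Function.update_of_ne hrs, Function.update_of_ne hrs]
        refine h r ?_
        have : (r : ℕ) ≠ m := fun e => hrs (Fin.ext e)
        omega
  obtain ⟨mu, w, h⟩ := key k le_rfl
  exact ⟨mu, w, fun r => h r r.isLt⟩

end PTensor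

/-! ### Multilinear algebra of tensors and the spectral norm -/

namespace PTensor

variable {p n k L : ℕ}

/-! Put `q = p - 1`. After deflation, `u ↦ A(I, u, …, u)` is the map `u ↦ ∑ lam_i ⟨v_i, u⟩^q v_i`
over the components not yet found, plus noise made of `E` and the errors of the pairs already
subtracted (`contract_deflate`). Scaling does not matter, so iterates are rescaled to have component
`1` along `v_j`, where `lam_j` is the largest remaining coefficient. The other components then
shrink like `b ↦ b^q` with `q ≥ 2`: a relative gap of order `1/√k` grows by the factor `3/2` per
step up to a constant, and from there the distance to `v_j` decays geometrically down to the noise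
level (`exists_iterate_near`). The squared norm stays below `n + 1/p`, so that `‖x‖^q ≤ 2 n^(q/2)`
with no factor exponential in `p`.

One good start per round is enough. It forces the selected end point to have value close to `lam_j`,
and such a vector must lie near some remaining `v_i` with `lam_j ≤ 2 lam_i`, perhaps not `v_j`
itself (`exists_near_of_large_value`). The second run of `T` iterations is then local and reaches
precision `e = ε / (10 √n)` (`exists_iterate_close`).

Errors do not accumulate over the rounds. Near a remaining `v_j`, a subtracted pair acts through
inner products with vectors almost orthogonal to `v_j`. Its error is therefore a small multiple of
the distance to `v_j` plus a term of second order in `e` (`norm_deflationNoise_le_of_near`), and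
every round attains the same `e`.

For the starts, coordinates in an orthonormal basis extending `v` are independent standard
Gaussians. By symmetry coordinate `j` is the largest, with square at least `2`, with probability of
order `1/k`. Shrinking that coordinate by `1 + γ` changes the density so little that the gap comes
almost for free (`gaussianReal_le_map_add`, `le_pi_gaussianReal_gapAtSet`). Independence and a union
bound over the `k²` pairs of round and component finish the argument. -/

theorem eval_add (A B : PTensor p n) (x : Fin p → EuclideanSpace ℝ (Fin n)) :
    eval (A + B) x = eval A x + eval B x := by
  simp [eval, add_mul, Finset.sum_add_distrib]

theorem eval_smul (c : ℝ) (A : PTensor p n) (x : Fin p → EuclideanSpace ℝ (Fin n)) :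
    eval (c • A) x = c * eval A x := by
  simp [eval, Finset.mul_sum, mul_assoc]

theorem eval_sub (A B : PTensor p n) (x : Fin p → EuclideanSpace ℝ (Fin n)) :
    eval (A - B) x = eval A x - eval B x := by
  simp [eval, sub_mul, Finset.sum_sub_distrib]

theorem eval_sum {ι : Type*} (s : Finset ι) (A : ι → PTensor p n)
    (x : Fin p → EuclideanSpace ℝ (Fin n)) :
    eval (∑ i ∈ s, A i) x = ∑ i ∈ s, eval (A i) x := by
  simp only [eval, Finset.sum_apply, Finset.sum_mul]
  exact Finset.sum_comm

theorem eval_rankOne (v : EuclideanSpace ℝ (Fin n)) (x : Fin p → EuclideanSpace ℝ (Fin n)) :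
    eval (rankOne p v) x = ∏ j, inner ℝ v (x j) := by
  simp only [eval, rankOne, PiLp.inner_apply, ← Finset.prod_mul_distrib]
  rw [Finset.prod_univ_sum, Fintype.piFinset_univ]
  simp [mul_comm]

theorem eval_smul_vec (A : PTensor p n) (c : Fin p → ℝ) (x : Fin p → EuclideanSpace ℝ (Fin n)) :
    eval A (fun j => c j • x j) = (∏ j, c j) * eval A x := by
  simp only [eval, PiLp.smul_apply, smul_eq_mul, Finset.prod_mul_distrib, Finset.mul_sum]
  exact Finset.sum_congr rfl fun i _ => by ring

theorem contract_apply (A : PTensor p n) (u : EuclideanSpace ℝ (Fin n)) (a : Fin n) :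
    contract A u a =
      eval A fun j => if (j : ℕ) = 0 then EuclideanSpace.single a (1 : ℝ) else u := rfl

theorem contract_add (A B : PTensor p n) (u : EuclideanSpace ℝ (Fin n)) :
    contract (A + B) u = contract A u + contract B u := by
  ext a; simp [contract_apply, eval_add]

theorem contract_sub (A B : PTensor p n) (u : EuclideanSpace ℝ (Fin n)) :
    contract (A - B) u = contract A u - contract B u := by
  ext a; simp [contract_apply, eval_sub]

theorem contract_smul (c : ℝ) (A : PTensor p n) (u : EuclideanSpace ℝ (Fin n)) :
    contract (c • A) u = c • contract A u := by
  ext a; simp [contract_apply, eval_smul]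

theorem contract_sum {ι : Type*} (s : Finset ι) (A : ι → PTensor p n)
    (u : EuclideanSpace ℝ (Fin n)) :
    contract (∑ i ∈ s, A i) u = ∑ i ∈ s, contract (A i) u := by
  ext a; simp [contract_apply, eval_sum]

/-- Pairing `A(I, u, …, u)` with `y` evaluates `A` at `(y, u, …, u)`. -/
theorem inner_contract (hp : 0 < p) (A : PTensor p n) (u y : EuclideanSpace ℝ (Fin n)) :
    inner ℝ (contract A u) y = eval A fun j => if (j : ℕ) = 0 then y else u := by
  obtain ⟨q, rfl⟩ : ∃ q, p = q + 1 := ⟨p - 1, by omega⟩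
  simp only [PiLp.inner_apply, contract_apply, eval, Fin.prod_univ_succ]
  simp only [Fin.val_zero, if_true, Fin.val_succ, Nat.succ_ne_zero, if_false,
    PiLp.single_apply]
  simp only [RCLike.inner_apply, conj_trivial, Finset.mul_sum]
  rw [Finset.sum_comm]
  refine Finset.sum_congr rfl fun i _ => ?_
  rw [Finset.sum_eq_single (i 0)]
  · simp; ring
  · intro b _ hb; simp [hb.symm]
  · simp

theorem value_eq_inner (hp : 0 < p) (A : PTensor p n) (u : EuclideanSpace ℝ (Fin n)) :
    value A u = inner ℝ (contract A u) u := by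
  simp [inner_contract hp, value]

theorem contract_rankOne (hp : 0 < p) (v u : EuclideanSpace ℝ (Fin n)) :
    contract (rankOne p v) u = inner ℝ v u ^ (p - 1) • v := by
  obtain ⟨q, rfl⟩ : ∃ q, p = q + 1 := ⟨p - 1, by omega⟩
  ext a
  simp [contract_apply, eval_rankOne, Fin.prod_univ_succ, mul_comm,
    EuclideanSpace.inner_single_right]

theorem contract_smul_vec (hp : 0 < p) (A : PTensor p n) (c : ℝ) (u : EuclideanSpace ℝ (Fin n)) :
    contract A (c • u) = c ^ (p - 1) • contract A u := by
  obtain ⟨q, rfl⟩ : ∃ q, p = q + 1 := ⟨p - 1, by omega⟩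
  ext a
  have := eval_smul_vec A (fun j : Fin (q + 1) => if (j : ℕ) = 0 then 1 else c)
    (fun j => if (j : ℕ) = 0 then EuclideanSpace.single a (1 : ℝ) else u)
  simp only [Fin.prod_univ_succ, Fin.val_zero, if_true, Fin.val_succ, Nat.succ_ne_zero, if_false,
    Finset.prod_const, Finset.card_univ, Fintype.card_fin, one_mul] at this
  simp only [contract_apply, PiLp.smul_apply, smul_eq_mul, Nat.add_sub_cancel, ← this]
  congr 1; funext j; split_ifs <;> simp

/-- A crude bound whose only purpose is to make the set in `spectralNorm` bounded; otherwise `sSup`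
would be the default value `0`. -/
theorem abs_eval_le_sum (E : PTensor p n) (x : Fin p → EuclideanSpace ℝ (Fin n))
    (hx : ∀ j, ‖x j‖ = 1) : |eval E x| ≤ ∑ i, |E i| := by
  refine (Finset.abs_sum_le_sum_abs _ _).trans (Finset.sum_le_sum fun i _ => ?_)
  rw [abs_mul, Finset.abs_prod]
  refine mul_le_of_le_one_right (abs_nonneg _) (Finset.prod_le_one (fun _ _ => abs_nonneg _) ?_)
  intro j _
  simpa [hx j] using PiLp.norm_apply_le (x j) (i j)

theorem spectralNorm_nonneg (E : PTensor p n) : 0 ≤ spectralNorm E :=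
  Real.sSup_nonneg (by rintro r ⟨x, -, rfl⟩; exact abs_nonneg _)

theorem abs_eval_le_spectralNorm (E : PTensor p n) (x : Fin p → EuclideanSpace ℝ (Fin n)) :
    |eval E x| ≤ spectralNorm E * ∏ j, ‖x j‖ := by
  by_cases h : ∀ j, x j ≠ 0
  · have hx : eval E x = (∏ j, ‖x j‖) * eval E fun j => ‖x j‖⁻¹ • x j := by
      rw [← eval_smul_vec]
      congr 1; funext j
      rw [smul_smul, mul_inv_cancel₀ (norm_ne_zero_iff.2 (h j)), one_smul]
    rw [hx, abs_mul, abs_of_nonneg (Finset.prod_nonneg fun _ _ => norm_nonneg _), mul_comm]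
    refine mul_le_mul_of_nonneg_right ?_ (Finset.prod_nonneg fun _ _ => norm_nonneg _)
    refine le_csSup ⟨∑ i, |E i|, ?_⟩ ⟨_, fun j => norm_smul_inv_norm (𝕜 := ℝ) (h j), rfl⟩
    rintro r ⟨y, hy, rfl⟩
    exact abs_eval_le_sum E y hy
  · push Not at h
    obtain ⟨j, hj⟩ := h
    have : eval E x = 0 :=
      Finset.sum_eq_zero fun i _ => by rw [Finset.prod_eq_zero (Finset.mem_univ j)] <;> simp [hj]
    rw [this, abs_zero]
    exact mul_nonneg (spectralNorm_nonneg E) (Finset.prod_nonneg fun _ _ => norm_nonneg _)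

/-- Duality: test the contraction against itself by putting it in the first slot. -/
theorem norm_contract_le (hp : 0 < p) (E : PTensor p n) (u : EuclideanSpace ℝ (Fin n)) :
    ‖contract E u‖ ≤ spectralNorm E * ‖u‖ ^ (p - 1) := by
  obtain ⟨q, rfl⟩ : ∃ q, p = q + 1 := ⟨p - 1, by omega⟩
  set w := contract E u with hw
  by_cases h0 : w = 0
  · rw [h0, norm_zero]; exact mul_nonneg (spectralNorm_nonneg E) (by positivity)
  have h1 : inner ℝ w w = ‖w‖ ^ 2 := real_inner_self_eq_norm_sq w
  have h2 := abs_eval_le_spectralNorm E fun j => if (j : ℕ) = 0 then w else u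
  rw [← inner_contract (Nat.succ_pos q), ← hw, h1, abs_of_nonneg (by positivity)] at h2
  simp only [Fin.prod_univ_succ, Fin.val_zero, if_true, Fin.val_succ, Nat.succ_ne_zero, if_false,
    Finset.prod_const, Finset.card_univ, Fintype.card_fin] at h2
  have hpos : 0 < ‖w‖ := norm_pos_iff.2 h0
  simp only [Nat.add_sub_cancel]
  nlinarith

theorem rankOne_neg (hp : Even p) (v : EuclideanSpace ℝ (Fin n)) :
    rankOne p (-v) = rankOne p v := by
  funext i
  simp [rankOne, Finset.prod_neg, hp]

end PTensor

/-! ### One step of the perturbed power map in normalized form -/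

section PowerMap

variable {V : Type*} [NormedAddCommGroup V] [InnerProductSpace ℝ V] {k : ℕ}

/-- The orthogonally decomposable map `u ↦ ∑_{i ∈ R} lam_i ⟨v_i, u⟩^q v_i` perturbed by `N`. -/
def perturbedPowerMap (q : ℕ) (lam : Fin k → ℝ) (v : Fin k → V) (R : Finset (Fin k))
    (N : V → V) (u : V) : V :=
  (∑ i ∈ R, (lam i * inner ℝ (v i) u ^ q) • v i) + N u

/-- The image of `u` under `F`, rescaled so that its component along `e` is `1`. -/
noncomputable def normalizedStep (F : V → V) (e u : V) : V := (inner ℝ e (F u))⁻¹ • F u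

variable {q : ℕ} {lam : Fin k → ℝ} {v : Fin k → V} {R : Finset (Fin k)} {N : V → V}

theorem Orthonormal.inner_sum_smul (hv : Orthonormal ℝ v) (a : Fin k → ℝ) (j : Fin k) :
    inner ℝ (v j) (∑ i ∈ R, a i • v i) = if j ∈ R then a j else 0 := by
  simp only [inner_sum, inner_smul_right, orthonormal_iff_ite.1 hv]
  simp

theorem Orthonormal.norm_sq_sum_smul (hv : Orthonormal ℝ v) (a : Fin k → ℝ) :
    ‖∑ i ∈ R, a i • v i‖ ^ 2 = ∑ i ∈ R, a i ^ 2 := by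
  rw [← real_inner_self_eq_norm_sq, sum_inner]
  refine Finset.sum_congr rfl fun i hi => ?_
  rw [inner_smul_left, hv.inner_sum_smul, if_pos hi]
  simp [sq]

theorem Orthonormal.abs_inner_le_norm (hv : Orthonormal ℝ v) (j : Fin k) (x : V) :
    |inner ℝ (v j) x| ≤ ‖x‖ := by
  simpa [hv.1 j] using abs_real_inner_le_norm (v j) x

theorem inner_perturbedPowerMap (hv : Orthonormal ℝ v) (j : Fin k) (x : V) :
    inner ℝ (v j) (perturbedPowerMap q lam v R N x) =
      (if j ∈ R then lam j * inner ℝ (v j) x ^ q else 0) + inner ℝ (v j) (N x) := by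
  rw [perturbedPowerMap, inner_add_right, hv.inner_sum_smul]

theorem le_inner_perturbedPowerMap (hv : Orthonormal ℝ v) {j : Fin k} (hj : j ∈ R) {x : V}
    {η : ℝ} (hx : inner ℝ (v j) x = 1) (hN : ‖N x‖ ≤ η * lam j) :
    (1 - η) * lam j ≤ inner ℝ (v j) (perturbedPowerMap q lam v R N x) := by
  rw [inner_perturbedPowerMap hv, if_pos hj, hx]
  have := (abs_le.1 ((hv.abs_inner_le_norm j (N x)).trans hN)).1
  simp only [one_pow, mul_one]
  linarith

theorem inner_normalizedStep_self {F : V → V} {e x : V} (h : inner ℝ e (F x) ≠ 0) :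
    inner ℝ e (normalizedStep F e x) = 1 := by
  rw [normalizedStep, inner_smul_right, inv_mul_cancel₀ h]

/-- One step contracts the ratio of each other component to the leading one. -/
theorem abs_inner_normalizedStep_le (hv : Orthonormal ℝ v) {i j : Fin k} (hj : j ∈ R)
    (hlam : ∀ i ∈ R, 0 < lam i ∧ lam i ≤ lam j) {x : V} {η b : ℝ} (hη : η < 1)
    (hx : inner ℝ (v j) x = 1)
    (hN : ‖N x‖ ≤ η * lam j) (hb : |inner ℝ (v i) x| ≤ b) :
    |inner ℝ (v i) (normalizedStep (perturbedPowerMap q lam v R N) (v j) x)|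
      ≤ (b ^ q + η) / (1 - η) := by
  have hlj := (hlam j hj).1
  have h1 := le_inner_perturbedPowerMap (q := q) hv hj hx hN
  have hpos : 0 < (1 - η) * lam j := mul_pos (by linarith) hlj
  have hb0 : 0 ≤ b := (abs_nonneg _).trans hb
  rw [normalizedStep, inner_smul_right, abs_mul, abs_inv, abs_of_pos (hpos.trans_le h1),
    inv_mul_eq_div]
  have h2 : |inner ℝ (v i) (perturbedPowerMap q lam v R N x)| ≤ (b ^ q + η) * lam j := by
    rw [inner_perturbedPowerMap hv]
    refine (abs_add_le _ _).trans ?_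
    have h3 := (hv.abs_inner_le_norm i (N x)).trans hN
    have h4 : |if i ∈ R then lam i * inner ℝ (v i) x ^ q else 0| ≤ b ^ q * lam j := by
      split_ifs with hi
      · rw [abs_mul, abs_pow, abs_of_pos (hlam i hi).1, mul_comm]
        exact mul_le_mul (pow_le_pow_left₀ (abs_nonneg _) hb q) (hlam i hi).2 (hlam i hi).1.le
          (by positivity)
      · rw [abs_zero]; positivity
    linarith
  rw [div_le_div_iff₀ (hpos.trans_le h1) (by linarith)]
  calc _ ≤ (b ^ q + η) * lam j * (1 - η) := by gcongr
    _ = (b ^ q + η) * ((1 - η) * lam j) := by ring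
    _ ≤ _ := by
      refine mul_le_mul_of_nonneg_left h1 ?_
      have : 0 ≤ η := by
        by_contra h
        have : η * lam j < 0 := mul_neg_of_neg_of_pos (not_le.1 h) hlj
        linarith [norm_nonneg (N x)]
      positivity

/-- One step brings the normalized iterate closer to the leading direction. -/
theorem norm_normalizedStep_sub_le (hv : Orthonormal ℝ v) {j : Fin k} (hj : j ∈ R)
    (hlj : 0 < lam j) {x : V} {η B : ℝ} (hη : η < 1) (hx : inner ℝ (v j) x = 1)
    (hN : ‖N x‖ ≤ η * lam j)
    (hB : ‖∑ i ∈ R.erase j, (lam i * inner ℝ (v i) x ^ q) • v i‖ ≤ B * lam j) :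
    ‖normalizedStep (perturbedPowerMap q lam v R N) (v j) x - v j‖ ≤ (B + η) / (1 - η) := by
  have h1 := le_inner_perturbedPowerMap (q := q) hv hj hx hN
  have hpos : 0 < (1 - η) * lam j := mul_pos (by linarith) hlj
  set d := inner ℝ (v j) (perturbedPowerMap q lam v R N x) with hd
  have hd0 : 0 < d := hpos.trans_le h1
  -- The component along `v j` cancels exactly, so the noise enters the numerator only through its
  -- part orthogonal to `v j`.
  have h2 : normalizedStep (perturbedPowerMap q lam v R N) (v j) x - v j =
      d⁻¹ • ((∑ i ∈ R.erase j, (lam i * inner ℝ (v i) x ^ q) • v i) +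
        (N x - inner ℝ (v j) (N x) • v j)) := by
    have : d⁻¹ • (d • v j) = v j := by rw [smul_smul, inv_mul_cancel₀ hd0.ne', one_smul]
    rw [normalizedStep, ← hd]
    refine (congrArg _ this.symm).trans ?_
    rw [← smul_sub]
    congr 1
    rw [hd, inner_perturbedPowerMap hv, if_pos hj, perturbedPowerMap, add_smul,
      ← Finset.add_sum_erase R _ hj]
    abel
  have h3 : ‖N x - inner ℝ (v j) (N x) • v j‖ ≤ ‖N x‖ := by
    refine le_of_sq_le_sq ?_ (norm_nonneg _)
    rw [← real_inner_self_eq_norm_sq, ← real_inner_self_eq_norm_sq (N x)]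
    simp only [inner_sub_left, inner_sub_right, inner_smul_left, inner_smul_right,
      real_inner_self_eq_norm_sq, hv.1 j, real_inner_comm (v j) (N x), conj_trivial]
    nlinarith [sq_nonneg (inner ℝ (v j) (N x))]
  rw [h2, norm_smul, norm_inv, Real.norm_of_nonneg hd0.le, inv_mul_eq_div]
  have hBη : 0 ≤ (B + η) * lam j := by
    have := norm_nonneg (N x)
    have := norm_nonneg (∑ i ∈ R.erase j, (lam i * inner ℝ (v i) x ^ q) • v i)
    linarith
  have h4 : 0 ≤ B + η := by
    by_contra h
    exact absurd hBη (not_le.2 (mul_neg_of_neg_of_pos (not_le.1 h) hlj))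
  rw [div_le_div_iff₀ hd0 (by linarith)]
  calc _ ≤ (B + η) * lam j * (1 - η) := by
        gcongr
        refine (norm_add_le _ _).trans ?_
        linarith
    _ = (B + η) * ((1 - η) * lam j) := by ring
    _ ≤ _ := mul_le_mul_of_nonneg_left h1 h4

/-- The norm of the part of the power map away from `v_j`. -/
theorem norm_sum_erase_le (hv : Orthonormal ℝ v) {j : Fin k} {ρ b : ℝ} (hb : 0 ≤ b)
    (hlam : ∀ i ∈ R, 0 < lam i ∧ lam i ≤ ρ) (hq : 1 ≤ q) {x : V}
    (hxb : ∀ i, i ≠ j → |inner ℝ (v i) x| ≤ b) (hρ : 0 ≤ ρ) :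
    ‖∑ i ∈ R.erase j, (lam i * inner ℝ (v i) x ^ q) • v i‖ ≤ ρ * b ^ (q - 1) * ‖x - v j‖ := by
  refine le_of_sq_le_sq ?_ (by positivity)
  rw [hv.norm_sq_sum_smul, mul_pow]
  have hbessel : ∑ i ∈ R.erase j, inner ℝ (v i) x ^ 2 ≤ ‖x - v j‖ ^ 2 := by
    have := hv.sum_inner_products_le (x - v j) (s := R.erase j)
    refine le_trans (Finset.sum_le_sum fun i hi => ?_) this
    rw [inner_sub_right, orthonormal_iff_ite.1 hv, if_neg (Finset.ne_of_mem_erase hi), sub_zero,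
      Real.norm_eq_abs, sq_abs]
  calc _ ≤ ∑ i ∈ R.erase j, (ρ * b ^ (q - 1)) ^ 2 * inner ℝ (v i) x ^ 2 := by
        refine Finset.sum_le_sum fun i hi => ?_
        rw [← mul_pow, sq_le_sq, abs_mul, abs_mul, abs_mul]
        obtain ⟨q, rfl⟩ : ∃ m, q = m + 1 := ⟨q - 1, by omega⟩
        have h1 := hlam i (Finset.mem_of_mem_erase hi)
        have h2 := hxb i (Finset.ne_of_mem_erase hi)
        rw [Nat.add_sub_cancel, pow_succ, abs_mul, ← mul_assoc, abs_of_pos h1.1,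
          abs_of_nonneg hρ, abs_pow, abs_pow, abs_of_nonneg hb]
        gcongr
        exact h1.2
    _ = (ρ * b ^ (q - 1)) ^ 2 * ∑ i ∈ R.erase j, inner ℝ (v i) x ^ 2 := by rw [Finset.mul_sum]
    _ ≤ _ := by gcongr

theorem norm_sq_eq_one_add (hv : Orthonormal ℝ v) {j : Fin k} {x : V}
    (hx : inner ℝ (v j) x = 1) : ‖x‖ ^ 2 = 1 + ‖x - v j‖ ^ 2 := by
  rw [norm_sub_sq_real, real_inner_comm, hx, hv.1 j]; ring

/-- A vector `u = c x` with `x` normalized stays of that form under the power iteration. -/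
theorem iterate_power_step (F : V → V) (hF : ∀ (c : ℝ) (u : V), F (c • u) = c ^ q • F u) (e : V)
    (P : ℕ → V → Prop)
    (hP : ∀ m x, P m x → 0 < inner ℝ e (F x) ∧ P (m + 1) (normalizedStep F e x))
    {u x : V} {c : ℝ} (hu : u = c • x) (hc : c ≠ 0) (hx : P 0 x) (m : ℕ) :
    ∃ (y : V) (d : ℝ), (fun w => ‖F w‖⁻¹ • F w)^[m] u = d • y ∧ d ≠ 0 ∧ P m y ∧
      (1 ≤ m → ‖d • y‖ = 1 ∧ (Even q → 0 < d)) := by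
  induction m with
  -- The start is neither normalized nor oriented, so norm and sign are claimed only from `m = 1`
  -- on.
  | zero => exact ⟨x, c, hu, hc, hx, fun h => by omega⟩
  | succ m ih =>
    obtain ⟨y, d, hy, hd, hPy, -⟩ := ih
    obtain ⟨hpos, hP'⟩ := hP m y hPy
    have hFy : F y ≠ 0 := fun h => by simp [h] at hpos
    have hdq : d ^ q ≠ 0 := pow_ne_zero _ hd
    have hstep : (fun w => ‖F w‖⁻¹ • F w)^[m + 1] u =
        (‖d ^ q • F y‖⁻¹ * d ^ q * inner ℝ e (F y)) • normalizedStep F e y := by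
      rw [Function.iterate_succ_apply', hy]
      simp only [hF, normalizedStep, smul_smul]
      rw [mul_assoc, mul_inv_cancel₀ hpos.ne', mul_one]
    have hnorm : ‖d ^ q • F y‖ ≠ 0 := by simp [hd, hFy]
    refine ⟨_, _, hstep, ?_, hP', fun _ => ⟨?_, fun hq => ?_⟩⟩
    · exact mul_ne_zero (mul_ne_zero (inv_ne_zero hnorm) hdq) hpos.ne'
    · rw [← hstep, Function.iterate_succ_apply', hy]
      simp only [hF]
      rw [norm_smul, norm_inv, norm_norm, inv_mul_cancel₀ hnorm]
    · have : 0 < d ^ q := lt_of_le_of_ne (hq.pow_nonneg d) hdq.symm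
      positivity

end PowerMap

/-! ### Global phase, local phase, and what a large value implies -/

section PowerMapPhases

variable {V : Type*} [NormedAddCommGroup V] [InnerProductSpace ℝ V] {k : ℕ}
variable {q : ℕ} {lam : Fin k → ℝ} {v : Fin k → V} {R : Finset (Fin k)} {N : V → V}

/-- The gap `1 - β` pays for the cross term: `2 √K β η ≤ K (1 - β) ≤ K (1 - β²)`. With `K = k - 1`
this keeps the squared norm of the iterates from growing over the steps; the alternative on `K` is
what gives `√K ≤ K`. -/
theorem sq_add_le_of_gap {K β η : ℝ} (hK : K = 0 ∨ 1 ≤ K) (hβ : 0 ≤ β)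
    (hη : 0 ≤ η) (h : 2 * η ≤ 1 - β) : (√K * β + η) ^ 2 ≤ K + η ^ 2 := by
  rcases hK with rfl | hK
  · simp
  have h1 : √K ^ 2 = K := Real.sq_sqrt (by linarith)
  have h2 : √K ≤ K := by
    rw [Real.sqrt_le_left (by linarith)]
    nlinarith
  have h3 : 2 * (√K * β * η) ≤ K * (1 - β) := by
    have : √K * β * η ≤ K * 1 * η := by gcongr; linarith
    nlinarith
  have h4 : K * (1 - β) ≤ K * (1 - β ^ 2) := by
    refine mul_le_mul_of_nonneg_left ?_ (by linarith)
    nlinarith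
  nlinarith

/-- Counts at most `k - 1` terms instead of using Bessel as in `norm_sum_erase_le`. The result
depends on `b` alone, which suits the phase where `x` is still far from `v j`. -/
theorem norm_sum_erase_le_sqrt (hv : Orthonormal ℝ v) {j : Fin k} (hj : j ∈ R) {b : ℝ}
    (hb : 0 ≤ b) (hlam : ∀ i ∈ R, 0 < lam i ∧ lam i ≤ lam j) {x : V}
    (hxb : ∀ i, i ≠ j → |inner ℝ (v i) x| ≤ b) :
    ‖∑ i ∈ R.erase j, (lam i * inner ℝ (v i) x ^ q) • v i‖
      ≤ (√((k : ℝ) - 1) * b ^ q) * lam j := by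
  have hlj := (hlam j hj).1
  have hk : (1 : ℝ) ≤ k := by exact_mod_cast Fin.pos j
  refine le_of_sq_le_sq ?_ (by positivity)
  rw [hv.norm_sq_sum_smul, mul_pow, mul_pow, Real.sq_sqrt (by linarith)]
  have hcard : ((R.erase j).card : ℝ) ≤ k - 1 := by
    have h1 := Finset.card_erase_of_mem hj
    have h2 := Finset.card_le_univ R
    have h3 := Finset.card_pos.2 ⟨j, hj⟩
    rw [Fintype.card_fin] at h2
    have : (R.erase j).card + 1 ≤ k := by omega
    have : ((R.erase j).card : ℝ) + 1 ≤ k := by exact_mod_cast this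
    linarith
  calc _ ≤ ∑ i ∈ R.erase j, (lam j * b ^ q) ^ 2 := by
        refine Finset.sum_le_sum fun i hi => ?_
        rw [sq_le_sq, abs_mul, abs_mul, abs_pow, abs_pow, abs_of_nonneg hb, abs_of_pos hlj]
        have h1 := hlam i (Finset.mem_of_mem_erase hi)
        rw [abs_of_pos h1.1]
        exact mul_le_mul h1.2 (pow_le_pow_left₀ (abs_nonneg _)
          (hxb i (Finset.ne_of_mem_erase hi)) q) (by positivity) hlj.le
    _ = (R.erase j).card * (lam j * b ^ q) ^ 2 := by simp
    _ ≤ (k - 1) * (lam j * b ^ q) ^ 2 := by gcongr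
    _ = _ := by ring

/-- A normalized iterate whose other components are at most `b`, of squared norm at most `M`. -/
def IsDominated (v : Fin k → V) (j : Fin k) (M b : ℝ) (x : V) : Prop :=
  inner ℝ (v j) x = 1 ∧ (∀ i, i ≠ j → |inner ℝ (v i) x| ≤ b) ∧ ‖x‖ ^ 2 ≤ M

/-- The new squared norm is at most `1 + (k - 1) + (2η)²` whatever the old one was, so the same `M`
serves at every step. -/
theorem IsDominated.step (hv : Orthonormal ℝ v) {j : Fin k} (hj : j ∈ R)
    (hlam : ∀ i ∈ R, 0 < lam i ∧ lam i ≤ lam j) {M η b b' : ℝ} {x : V} (hb : 0 ≤ b)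
    (hη0 : 0 ≤ η) (hη : η ≤ 1 / 2) (hx : IsDominated v j M b x) (hN : ‖N x‖ ≤ η * lam j)
    (hM : k + 4 * η ^ 2 ≤ M) (hb' : (b ^ q + η) / (1 - η) ≤ b') (hgap : 4 * η ≤ 1 - b') :
    IsDominated v j M b' (normalizedStep (perturbedPowerMap q lam v R N) (v j) x) := by
  have hlj := (hlam j hj).1
  have hpos : 0 < (1 - η) * lam j := mul_pos (by linarith) hlj
  have h1 : inner ℝ (v j) (normalizedStep (perturbedPowerMap q lam v R N) (v j) x) = 1 :=
    inner_normalizedStep_self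
      (hpos.trans_le (le_inner_perturbedPowerMap hv hj hx.1 hN)).ne'
  refine ⟨h1, fun i hi => ?_, ?_⟩
  · exact (abs_inner_normalizedStep_le hv hj hlam (by linarith) hx.1 hN (hx.2.1 i hi)).trans hb'
  · rw [norm_sq_eq_one_add hv h1]
    have h2 := norm_normalizedStep_sub_le (q := q) hv hj hlj (by linarith) hx.1 hN
      (norm_sum_erase_le_sqrt hv hj hb hlam hx.2.1)
    have hη1 : η / (1 - η) ≤ 2 * η := by
      rw [div_le_iff₀ (by linarith)]; nlinarith
    have hη2 : 0 ≤ η / (1 - η) := div_nonneg hη0 (by linarith)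
    have h3 : 0 ≤ b ^ q / (1 - η) := div_nonneg (by positivity) (by linarith)
    have hK : (k : ℝ) - 1 = 0 ∨ 1 ≤ (k : ℝ) - 1 := by
      have hk1 := Fin.pos j
      rcases Nat.lt_or_ge 1 k with h | h
      · right
        have : (2 : ℝ) ≤ k := by exact_mod_cast h
        linarith
      · left
        have : k = 1 := by omega
        simp [this]
    have h4 : b ^ q / (1 - η) ≤ b' := le_trans (by gcongr <;> linarith) hb'
    have h5 := sq_add_le_of_gap hK h3 hη2 (by linarith)
    have h6 : (√((k : ℝ) - 1) * b ^ q + η) / (1 - η)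
        = √((k : ℝ) - 1) * (b ^ q / (1 - η)) + η / (1 - η) := by ring
    rw [h6] at h2
    have h7 : (η / (1 - η)) ^ 2 ≤ (2 * η) ^ 2 := by gcongr
    have h8 := pow_le_pow_left₀ (norm_nonneg _) h2 2
    nlinarith

/-- Starting from a small multiplicative gap, the power iteration makes `v_j` dominant and then
approaches it up to the noise level. -/
theorem exists_iterate_near (hv : Orthonormal ℝ v) (hq : 2 ≤ q) {j : Fin k} (hj : j ∈ R)
    (hlam : ∀ i ∈ R, 0 < lam i ∧ lam i ≤ lam j) {M η γ : ℝ} (hη0 : 0 ≤ η) (hη : η ≤ 1 / 32)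
    (hγ : 8 * η ≤ γ) (hγ0 : 0 < γ) (hγ1 : γ ≤ 1 / 4) (hM : k + 4 * η ^ 2 ≤ M)
    (hF : ∀ (c : ℝ) (u : V), perturbedPowerMap q lam v R N (c • u) =
      c ^ q • perturbedPowerMap q lam v R N u)
    (hN : ∀ x, IsDominated v j M 1 x → ‖N x‖ ≤ η * lam j)
    {x : V} {c : ℝ} (hc : c ≠ 0) (hx : IsDominated v j M (1 - γ) x)
    {m₁ m₂ : ℕ} (hm₁ : 1 / 4 ≤ γ * (3 / 2) ^ m₁) (hm₂ : 1 ≤ m₂) :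
    ∃ (y : V) (d : ℝ), (fun w => ‖perturbedPowerMap q lam v R N w‖⁻¹ •
        perturbedPowerMap q lam v R N w)^[m₂ + m₁] (c • x) = d • y ∧ d ≠ 0 ∧
      inner ℝ (v j) y = 1 ∧ ‖y - v j‖ ≤ (4 / 5) ^ m₂ * √M + 10 * η ∧
      ‖d • y‖ = 1 ∧ (Even q → 0 < d) := by
  have hlj := (hlam j hj).1
  have hpos : 0 < (1 - η) * lam j := mul_pos (by linarith) hlj
  have hsq : ∀ b : ℝ, 0 ≤ b → b ≤ 1 → b ^ q ≤ b ^ 2 := fun b h0 h1 =>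
    pow_le_pow_of_le_one h0 h1 hq
  have mono : ∀ {b : ℝ} {x : V}, b ≤ 1 → IsDominated v j M b x → IsDominated v j M 1 x :=
    fun hb hx => ⟨hx.1, fun i hi => (hx.2.1 i hi).trans hb, hx.2.2⟩
  obtain ⟨x₁, c₁, hx₁, hc₁, hP₁, -⟩ := iterate_power_step (perturbedPowerMap q lam v R N) hF (v j)
    (fun m x => IsDominated v j M (1 - min (1 / 4) (γ * (3 / 2) ^ m)) x) (by
      intro m x hx
      set g := min (1 / 4) (γ * (3 / 2) ^ m) with hg
      have hgγ : γ ≤ g := le_min hγ1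
        (le_mul_of_one_le_right hγ0.le (one_le_pow₀ (by norm_num)))
      have hg4 : g ≤ 1 / 4 := min_le_left _ _
      have hNx := hN x (mono (by linarith) hx)
      refine ⟨hpos.trans_le (le_inner_perturbedPowerMap hv hj hx.1 hNx), ?_⟩
      have hg' : min (1 / 4) (γ * (3 / 2) ^ (m + 1)) ≤ 3 / 2 * g := by
        rw [hg, mul_min_of_nonneg _ _ (by norm_num), pow_succ]
        refine min_le_min (by norm_num) (by linarith)
      have hg'4 : min (1 / 4) (γ * (3 / 2) ^ (m + 1)) ≤ 1 / 4 := min_le_left _ _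
      have hg'γ : γ ≤ min (1 / 4) (γ * (3 / 2) ^ (m + 1)) := le_min hγ1
        (le_mul_of_one_le_right hγ0.le (one_le_pow₀ (by norm_num)))
      -- Since `g ≤ 1/4`, `(1 - g)^q ≤ (1 - g)² ≤ 1 - 7g/4`, and `η ≤ g/8` leaves enough room for `1
      -- - 3g/2`.
      refine hx.step hv hj hlam (by linarith) hη0 (by linarith) hNx hM ?_ (by linarith)
      rw [div_le_iff₀ (by linarith)]
      have := hsq (1 - g) (by linarith) (by linarith)
      nlinarith) (x := x) rfl hc (by rw [pow_zero, mul_one, min_eq_right hγ1]; exact hx) m₁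
  rw [min_eq_left hm₁] at hP₁
  have hM0 : 0 ≤ M := (sq_nonneg _).trans hx.2.2
  -- Once the other components are at most `3/4`, the distance obeys `t ↦ (3t/4 + η) / (1 - η)`; as
  -- `η ≤ 1/32`, the rate is below `4/5` and the noise floor below `10η`.
  obtain ⟨y, d, hy, hd, hP₂, hfin⟩ :=
    iterate_power_step (perturbedPowerMap q lam v R N) hF (v j)
    (fun m x => IsDominated v j M (3 / 4) x ∧ ‖x - v j‖ ≤ (4 / 5) ^ m * √M + 10 * η) (by
      rintro m x ⟨hx, hxt⟩
      have hNx := hN x (mono (by norm_num) hx)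
      refine ⟨hpos.trans_le (le_inner_perturbedPowerMap hv hj hx.1 hNx), ?_, ?_⟩
      · refine hx.step hv hj hlam (by norm_num) hη0 (by linarith) hNx hM ?_ (by linarith)
        rw [div_le_iff₀ (by linarith)]
        have := hsq (3 / 4) (by norm_num) (by norm_num)
        nlinarith
      · have h1 := norm_normalizedStep_sub_le (q := q) (B := 3 / 4 * ‖x - v j‖) hv hj hlj (by linarith)
          hx.1 hNx (by
            refine (norm_sum_erase_le (b := 3 / 4) hv (by norm_num) hlam (by omega) hx.2.1
              hlj.le).trans ?_
            have h2 : (3 / 4 : ℝ) ^ (q - 1) ≤ 3 / 4 := by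
              simpa using pow_le_pow_of_le_one (by norm_num : (0 : ℝ) ≤ 3 / 4) (by norm_num)
                (by omega : 1 ≤ q - 1)
            calc lam j * (3 / 4) ^ (q - 1) * ‖x - v j‖ ≤ lam j * (3 / 4) * ‖x - v j‖ := by gcongr
              _ = _ := by ring)
        refine h1.trans ?_
        rw [div_le_iff₀ (by linarith), pow_succ]
        have h3 := norm_nonneg (x - v j)
        have h4 : 0 ≤ (4 / 5) ^ m * √M := by positivity
        nlinarith) hx₁ hc₁ ⟨by norm_num at hP₁ ⊢; exact hP₁, by
          have h1 := norm_sq_eq_one_add hv hP₁.1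
          have h2 : ‖x₁ - v j‖ ≤ √M := Real.le_sqrt_of_sq_le (by linarith [hP₁.2.2])
          simp only [pow_zero, one_mul]
          linarith⟩ m₂
  refine ⟨y, d, ?_, hd, hP₂.1.1, hP₂.2, hfin hm₂⟩
  rw [Function.iterate_add_apply, hx₁, ← hx₁, ← hy, hx₁]

/-- Local convergence: close to `v_j` the iteration contracts up to precision `δ`. -/
theorem exists_iterate_close (hv : Orthonormal ℝ v) (hq : 2 ≤ q) {j : Fin k} (hj : j ∈ R)
    (hlam : ∀ i ∈ R, 0 < lam i ∧ lam i ≤ 2 * lam j) {δ τ : ℝ} (hδ : 0 ≤ δ) (hδτ : δ ≤ τ)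
    (hτ : τ ≤ 1 / 16)
    (hF : ∀ (c : ℝ) (u : V), perturbedPowerMap q lam v R N (c • u) =
      c ^ q • perturbedPowerMap q lam v R N u)
    (hN : ∀ x, inner ℝ (v j) x = 1 → ‖x - v j‖ ≤ τ →
      ‖N x‖ ≤ (21 / 100 * δ + 1 / 100 * ‖x - v j‖) * lam j)
    {x : V} {c : ℝ} (hc : c ≠ 0) (hx : inner ℝ (v j) x = 1) (hxτ : ‖x - v j‖ ≤ τ)
    {m : ℕ} (hm : 1 ≤ m) (hmδ : (1 / 4) ^ m ≤ δ / 2) :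
    ∃ (y : V) (d : ℝ), (fun w => ‖perturbedPowerMap q lam v R N w‖⁻¹ •
        perturbedPowerMap q lam v R N w)^[m] (c • x) = d • y ∧ d ≠ 0 ∧
      inner ℝ (v j) y = 1 ∧ ‖y - v j‖ ≤ δ ∧ ‖d • y‖ = 1 ∧ (Even q → 0 < d) := by
  have hlj := (hlam j hj).1
  obtain ⟨y, d, hy, hd, hP, hfin⟩ :=
    iterate_power_step (perturbedPowerMap q lam v R N) hF (v j)
    (fun m x => inner ℝ (v j) x = 1 ∧ ‖x - v j‖ ≤ τ ∧ ‖x - v j‖ ≤ (1 / 4) ^ m + δ / 2) (by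
      rintro m x ⟨hx, hxτ, hxm⟩
      have hNx := hN x hx hxτ
      have ht := norm_nonneg (x - v j)
      have hη : 21 / 100 * δ + 1 / 100 * ‖x - v j‖ ≤ 1 / 64 := by linarith
      have hpos := le_inner_perturbedPowerMap (q := q) hv hj hx hNx
      have hpos' : 0 < inner ℝ (v j) (perturbedPowerMap q lam v R N x) :=
        lt_of_lt_of_le (mul_pos (by linarith) hlj) hpos
      have h1 := norm_normalizedStep_sub_le (q := q) (B := 1 / 8 * ‖x - v j‖) hv hj hlj (by linarith)
          hx hNx (by
            refine (norm_sum_erase_le (b := ‖x - v j‖) hv ht hlam (by omega)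
              (fun i hi => ?_) (by linarith)).trans ?_
            · have := hv.abs_inner_le_norm i (x - v j)
              rwa [inner_sub_right, orthonormal_iff_ite.1 hv, if_neg hi, sub_zero] at this
            · have h2 : ‖x - v j‖ ^ (q - 1) ≤ ‖x - v j‖ := by
                simpa using pow_le_pow_of_le_one ht (by linarith) (by omega : 1 ≤ q - 1)
              calc 2 * lam j * ‖x - v j‖ ^ (q - 1) * ‖x - v j‖
                  ≤ 2 * lam j * (1 / 16) * ‖x - v j‖ := by gcongr; linarith
                _ = _ := by ring)
      -- The recursion `t ↦ t/4 + δ/4` has fixed point `δ/3`, below the `δ/2` of the invariant.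
      have h2 : ‖normalizedStep (perturbedPowerMap q lam v R N) (v j) x - v j‖
          ≤ 1 / 4 * ‖x - v j‖ + 1 / 4 * δ := by
        refine h1.trans ?_
        rw [div_le_iff₀ (by linarith)]
        nlinarith
      refine ⟨hpos', inner_normalizedStep_self hpos'.ne', by linarith, ?_⟩
      rw [pow_succ]
      linarith) rfl hc ⟨hx, hxτ, by simp only [pow_zero]; linarith⟩ m
  exact ⟨y, d, hy, hd, hP.1, hP.2.2.trans (by linarith), hfin hm⟩

theorem inner_perturbedPowerMap_self (u : V) :
    inner ℝ (perturbedPowerMap q lam v R N u) u =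
      (∑ i ∈ R, lam i * inner ℝ (v i) u ^ (q + 1)) + inner ℝ (N u) u := by
  simp only [perturbedPowerMap, inner_add_left, sum_inner, inner_smul_left, conj_trivial, pow_succ,
    mul_assoc]

/-- The value of the form at a unit vector close to `v_j` is close to `lam_j`. -/
theorem abs_inner_perturbedPowerMap_self_sub_le (hv : Orthonormal ℝ v) (hq : 2 ≤ q) {j : Fin k}
    (hj : j ∈ R) (hlam : ∀ i ∈ R, 0 < lam i ∧ lam i ≤ 2 * lam j) {x : V} {c : ℝ}
    (hx : inner ℝ (v j) x = 1) (hc : ‖c • x‖ = 1) (hcpos : Even q → 0 < c) :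
    |inner ℝ (perturbedPowerMap q lam v R N (c • x)) (c • x) - lam j|
      ≤ (q + 3) * lam j * ‖x - v j‖ ^ 2 + ‖N (c • x)‖ := by
  have hlj := (hlam j hj).1
  set t := ‖x - v j‖ with ht
  have hxn := norm_sq_eq_one_add hv hx
  have hc2 : c ^ 2 * (1 + t ^ 2) = 1 := by
    rw [← hxn, ← sq_abs c, ← mul_pow, ← Real.norm_eq_abs, ← norm_smul, hc, one_pow]
  have hcle : |c| ≤ 1 := by
    rw [← sq_le_one_iff_abs_le_one]; nlinarith [sq_nonneg (c * t)]
  have hcq : c ^ (q + 1) = |c| ^ (q + 1) := by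
    rcases Nat.even_or_odd q with h | h
    · rw [abs_of_pos (hcpos h)]
    · rw [Even.pow_abs (Odd.add_odd h odd_one)]
  -- Bernoulli's inequality applied to `c² = 1 / (1 + t²)`, after `|c| ≥ c²`.
  have hlow : 1 - (q + 1) * t ^ 2 ≤ c ^ (q + 1) := by
    have h1 : (c ^ 2) ^ (q + 1) ≤ |c| ^ (q + 1) := by
      rw [← sq_abs]
      refine pow_le_pow_left₀ (by positivity) ?_ _
      nlinarith [abs_nonneg c]
    have h2 := one_add_mul_le_pow (a := c ^ 2 - 1) (by nlinarith) (q + 1)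
    rw [add_sub_cancel] at h2
    push_cast at h2
    have h3 : 1 - c ^ 2 ≤ t ^ 2 := by nlinarith [mul_nonneg (sq_nonneg t) (sq_nonneg t)]
    have h4 : ((q : ℝ) + 1) * (1 - c ^ 2) ≤ (q + 1) * t ^ 2 := by gcongr
    rw [hcq]; linarith
  have hhigh : c ^ (q + 1) ≤ 1 := by
    rw [hcq]; exact pow_le_one₀ (abs_nonneg _) hcle
  have hrest : |∑ i ∈ R.erase j, lam i * inner ℝ (v i) (c • x) ^ (q + 1)|
      ≤ 2 * lam j * t ^ 2 := by
    refine (Finset.abs_sum_le_sum_abs _ _).trans ?_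
    have hbessel := hv.sum_inner_products_le (x - v j) (s := R.erase j)
    calc _ ≤ ∑ i ∈ R.erase j, 2 * lam j * ‖inner ℝ (v i) (x - v j)‖ ^ 2 := by
          refine Finset.sum_le_sum fun i hi => ?_
          have h1 := hlam i (Finset.mem_of_mem_erase hi)
          rw [inner_sub_right, orthonormal_iff_ite.1 hv, if_neg (Finset.ne_of_mem_erase hi),
            sub_zero, abs_mul, abs_pow, abs_of_pos h1.1, Real.norm_eq_abs]
          have h2 : |inner ℝ (v i) (c • x)| ≤ 1 := hc ▸ hv.abs_inner_le_norm i (c • x)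
          have h3 : |inner ℝ (v i) (c • x)| ≤ |inner ℝ (v i) x| := by
            rw [inner_smul_right, abs_mul]
            exact mul_le_of_le_one_left (abs_nonneg _) hcle
          have h4 : |inner ℝ (v i) (c • x)| ^ (q + 1) ≤ |inner ℝ (v i) x| ^ 2 :=
            (pow_le_pow_of_le_one (abs_nonneg _) h2 (by omega : 2 ≤ q + 1)).trans
              (pow_le_pow_left₀ (abs_nonneg _) h3 2)
          exact mul_le_mul h1.2 h4 (by positivity) (by positivity)
      _ = 2 * lam j * ∑ i ∈ R.erase j, ‖inner ℝ (v i) (x - v j)‖ ^ 2 := by rw [Finset.mul_sum]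
      _ ≤ _ := by gcongr
  have hnoise : |inner ℝ (N (c • x)) (c • x)| ≤ ‖N (c • x)‖ := by
    simpa [hc] using abs_real_inner_le_norm (N (c • x)) (c • x)
  rw [inner_perturbedPowerMap_self, ← Finset.add_sum_erase R _ hj]
  have hj1 : inner ℝ (v j) (c • x) = c := by rw [inner_smul_right, hx, mul_one]
  rw [hj1]
  have h5 : |lam j * c ^ (q + 1) - lam j| ≤ lam j * ((q + 1) * t ^ 2) := by
    have : lam j * c ^ (q + 1) - lam j = lam j * (c ^ (q + 1) - 1) := by ring
    rw [this, abs_mul, abs_of_pos hlj, abs_of_nonpos (by linarith)]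
    gcongr
    linarith
  calc _ = |(lam j * c ^ (q + 1) - lam j) + (∑ i ∈ R.erase j, lam i *
        inner ℝ (v i) (c • x) ^ (q + 1)) + inner ℝ (N (c • x)) (c • x)| := by congr 1; ring
    _ ≤ _ := (abs_add_three _ _ _).trans (by linarith)

/-- A vector of the unit ball at which the form is nearly as large as the largest coefficient is
close, up to scaling, to one of the `v_i` with a comparable coefficient. -/
theorem exists_near_of_large_value (hv : Orthonormal ℝ v) (hq : 2 ≤ q) {j : Fin k}
    (hj : j ∈ R) (hlam : ∀ i ∈ R, 0 < lam i ∧ lam i ≤ lam j) {u : V} (hu : ‖u‖ ≤ 1)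
    (hN : ‖N u‖ ≤ 1 / 1500 * lam j)
    (hval : (1 - 1 / 1500) * lam j ≤ inner ℝ (perturbedPowerMap q lam v R N u) u) :
    ∃ i ∈ R, inner ℝ (v i) u ≠ 0 ∧ lam j ≤ 2 * lam i ∧
      (q + 1) * ‖(inner ℝ (v i) u)⁻¹ • u - v i‖ ^ 2 ≤ 1 / 100 := by
  have hlj := (hlam j hj).1
  -- Writing the value as a sum of these weights times `⟨v_i, u⟩²`, Bessel bounds it by the largest
  -- weight. That weight is then almost `lam j`, which forces both `lam i` and `|⟨v_i, u⟩|` to be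
  -- large.
  obtain ⟨i, hi, hmax⟩ := R.exists_max_image (fun i => lam i * |inner ℝ (v i) u| ^ (q - 1)) ⟨j, hj⟩
  set a := inner ℝ (v i) u with ha
  have hli := hlam i hi
  have hnoise : |inner ℝ (N u) u| ≤ ‖N u‖ :=
    (abs_real_inner_le_norm _ _).trans (mul_le_of_le_one_right (norm_nonneg _) hu)
  have hsum : ∑ i ∈ R, lam i * inner ℝ (v i) u ^ (q + 1) ≤ lam i * |a| ^ (q - 1) := by
    calc _ ≤ ∑ l ∈ R, (lam i * |a| ^ (q - 1)) * ‖inner ℝ (v l) u‖ ^ 2 := by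
          refine Finset.sum_le_sum fun l hl => ?_
          have h1 : inner ℝ (v l) u ^ (q + 1) ≤ |inner ℝ (v l) u| ^ (q - 1) *
              |inner ℝ (v l) u| ^ 2 := by
            rw [← pow_add, show q - 1 + 2 = q + 1 by omega, ← abs_pow]
            exact le_abs_self _
          calc _ ≤ lam l * (|inner ℝ (v l) u| ^ (q - 1) * |inner ℝ (v l) u| ^ 2) :=
                mul_le_mul_of_nonneg_left h1 (hlam l hl).1.le
            _ = (lam l * |inner ℝ (v l) u| ^ (q - 1)) * |inner ℝ (v l) u| ^ 2 := by ring
            _ ≤ _ := by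
              rw [Real.norm_eq_abs]
              exact mul_le_mul_of_nonneg_right (hmax l hl) (by positivity)
      _ = (lam i * |a| ^ (q - 1)) * ∑ l ∈ R, ‖inner ℝ (v l) u‖ ^ 2 := by rw [Finset.mul_sum]
      _ ≤ (lam i * |a| ^ (q - 1)) * 1 := by
          refine mul_le_mul_of_nonneg_left ?_ (mul_nonneg hli.1.le (by positivity))
          exact (hv.sum_inner_products_le u).trans (pow_le_one₀ (norm_nonneg _) hu)
      _ = _ := mul_one _
  rw [inner_perturbedPowerMap_self] at hval
  have hW : (1 - 2 / 1500) * lam j ≤ lam i * |a| ^ (q - 1) := by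
    have := (abs_le.1 hnoise).2
    linarith
  have ha1 : |a| ≤ 1 := (hv.abs_inner_le_norm i u).trans hu
  have hapow : |a| ^ (q - 1) ≤ 1 := pow_le_one₀ (abs_nonneg _) ha1
  have ha0 : a ≠ 0 := by
    intro h
    rw [h, abs_zero, zero_pow (by omega), mul_zero] at hW
    linarith
  have hapos : 0 < |a| := abs_pos.2 ha0
  refine ⟨i, hi, ha0, ?_, ?_⟩
  · have : lam i * |a| ^ (q - 1) ≤ lam i * 1 := mul_le_mul_of_nonneg_left hapow hli.1.le
    linarith
  have hapow' : 1 - 2 / 1500 ≤ |a| ^ (q - 1) := by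
    have : lam i * |a| ^ (q - 1) ≤ lam j * |a| ^ (q - 1) :=
      mul_le_mul_of_nonneg_right hli.2 (by positivity)
    have h2 : lam j * (1 - 2 / 1500) ≤ lam j * |a| ^ (q - 1) := by linarith
    exact le_of_mul_le_mul_left h2 hlj
  have hx1 : inner ℝ (v i) (a⁻¹ • u) = 1 := by
    rw [inner_smul_right, ← ha, inv_mul_cancel₀ ha0]
  set t := ‖a⁻¹ • u - v i‖ with ht
  have hxn := norm_sq_eq_one_add hv hx1
  rw [← ht, norm_smul, norm_inv, mul_pow, Real.norm_eq_abs, inv_pow] at hxn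
  have hat : |a| ^ 2 * (1 + t ^ 2) ≤ 1 := by
    rw [← hxn, ← mul_assoc, mul_inv_cancel₀ (by positivity), one_mul]
    exact pow_le_one₀ (norm_nonneg _) hu
  -- Here `|a|^(q-1)` is close to `1` and `|a|² (1 + t²) ≤ 1`; Bernoulli turns this into a bound on
  -- `(q - 1) t²`.
  have hbern := one_add_mul_le_pow (a := t ^ 2) (by nlinarith [sq_nonneg t]) (q - 1)
  have hprod : (|a| ^ (q - 1)) ^ 2 * (1 + t ^ 2) ^ (q - 1) ≤ 1 := by
    rw [← pow_mul, mul_comm (q - 1) 2, pow_mul, ← mul_pow]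
    exact pow_le_one₀ (by positivity) hat
  have hsq : (1 - 2 / 1500 : ℝ) ^ 2 ≤ (|a| ^ (q - 1)) ^ 2 := by gcongr
  have hqq : ((q : ℝ) + 1) ≤ 3 * ((q - 1 : ℕ) : ℝ) := by
    have : q + 1 ≤ 3 * (q - 1) := by omega
    exact_mod_cast this
  have h6 : (1 - 2 / 1500 : ℝ) ^ 2 * (1 + ((q - 1 : ℕ) : ℝ) * t ^ 2) ≤ 1 :=
    (mul_le_mul hsq hbern (by positivity) (by positivity)).trans hprod
  have h7 : ((q : ℝ) + 1) * t ^ 2 ≤ 3 * ((q - 1 : ℕ) : ℝ) * t ^ 2 := by gcongr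
  norm_num at h6
  nlinarith

/-- A unit vector of the form `c x` with `⟨e, x⟩ = 1` and `c > 0` is as close to `e` as `x` is. -/
theorem norm_sub_le_of_normalized {e x : V} {c : ℝ} (he : ‖e‖ = 1) (hx : inner ℝ e x = 1)
    (hc : ‖c • x‖ = 1) (hpos : 0 < c) : ‖e - c • x‖ ≤ ‖x - e‖ := by
  refine le_of_sq_le_sq ?_ (norm_nonneg _)
  have hxn : ‖x - e‖ ^ 2 = ‖x‖ ^ 2 - 1 := by
    rw [norm_sub_sq_real, real_inner_comm, hx, he]; ring
  rw [hxn, norm_sub_sq_real, hc, he, inner_smul_right, hx]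
  rw [norm_smul, Real.norm_of_nonneg hpos.le] at hc
  have h1 : ‖x‖ = c⁻¹ := eq_inv_of_mul_eq_one_right hc
  have h2 : c * c⁻¹ = 1 := mul_inv_cancel₀ hpos.ne'
  rw [h1]
  have h3 : 0 < c⁻¹ := inv_pos.2 hpos
  set d := c⁻¹
  -- The claim is `2 - 2c ≤ d² - 1` with `d = c⁻¹`; modulo `c d = 1` the difference is `(d - 1)² (1
  -- + 2c)`.
  have : 0 ≤ d ^ 2 - 3 + 2 * c := by
    have : d ^ 2 - 3 + 2 * c = (d - 1) ^ 2 * (1 + 2 * c) +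
        (c * d - 1) * (-2 * d + 4) := by ring
    rw [this, h2]
    nlinarith [sq_nonneg (d - 1)]
  linarith

end PowerMapPhases

/-! ### Size of the noise left by deflation -/

section DeflationNoise

variable {V : Type*} [NormedAddCommGroup V] [InnerProductSpace ℝ V] {k : ℕ}

/-- Replacing `(lam, v)` by a nearby pair `(mu, w)` in a rank-one term. -/
theorem norm_rankOne_term_sub_le {v w u : V} (hv : ‖v‖ = 1) (hw : ‖w‖ = 1) {lam mu e : ℝ}
    (hlam : 0 < lam) (hvw : ‖v - w‖ ≤ e / lam) (hmu : |lam - mu| ≤ e) {q : ℕ} (hq : 1 ≤ q) :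
    ‖(lam * inner ℝ v u ^ q) • v - (mu * inner ℝ w u ^ q) • w‖
      ≤ (q + 2) * e * max |inner ℝ v u| |inner ℝ w u| ^ (q - 1) * ‖u‖ := by
  set α := inner ℝ v u with hα
  set β := inner ℝ w u with hβ
  set m := max |α| |β| with hm
  have he : 0 ≤ e := (abs_nonneg _).trans hmu
  have hm0 : 0 ≤ m := (abs_nonneg _).trans (le_max_left _ _)
  have hα1 : |α| ≤ ‖u‖ := by simpa [hv] using abs_real_inner_le_norm v u
  have hβ1 : |β| ≤ ‖u‖ := by simpa [hw] using abs_real_inner_le_norm w u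
  have hmu1 : m ≤ ‖u‖ := max_le hα1 hβ1
  have hdiff : |α - β| ≤ e / lam * ‖u‖ := by
    rw [hα, hβ, ← inner_sub_left]
    exact (abs_real_inner_le_norm _ _).trans (by gcongr)
  have hpow : |α ^ q - β ^ q| ≤ e / lam * ‖u‖ * q * m ^ (q - 1) :=
    (abs_pow_sub_pow_le α β q).trans (by gcongr)
  have hβq : |β ^ q| ≤ m ^ (q - 1) * ‖u‖ := by
    rw [abs_pow]
    calc |β| ^ q ≤ m ^ q := by gcongr; exact le_max_right _ _
      _ = m ^ (q - 1) * m := by rw [← pow_succ]; congr 1; omega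
      _ ≤ _ := by gcongr
  -- The inner product, the vector and the coefficient are exchanged one at a time; their errors
  -- give the factor `q + 1 + 1`.
  have hsplit : (lam * α ^ q) • v - (mu * β ^ q) • w =
      (lam * (α ^ q - β ^ q)) • v + (lam * β ^ q) • (v - w) + ((lam - mu) * β ^ q) • w := by
    module
  rw [hsplit]
  refine (norm_add₃_le).trans ?_
  rw [norm_smul, norm_smul, norm_smul, hv, hw, mul_one, mul_one, Real.norm_eq_abs,
    Real.norm_eq_abs, Real.norm_eq_abs, abs_mul, abs_mul, abs_mul, abs_of_pos hlam]
  have h1 : lam * |α ^ q - β ^ q| ≤ q * e * m ^ (q - 1) * ‖u‖ := by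
    calc _ ≤ lam * (e / lam * ‖u‖ * q * m ^ (q - 1)) := by gcongr
      _ = _ := by field_simp
  have h2 : lam * |β ^ q| * ‖v - w‖ ≤ e * m ^ (q - 1) * ‖u‖ := by
    calc _ ≤ lam * (m ^ (q - 1) * ‖u‖) * (e / lam) := by gcongr
      _ = _ := by field_simp
  have h3 : |lam - mu| * |β ^ q| ≤ e * m ^ (q - 1) * ‖u‖ := by
    calc _ ≤ e * (m ^ (q - 1) * ‖u‖) := by gcongr
      _ = _ := by ring
  linarith

/-- The perturbation after deflation: a noise map together with the errors of the pairs `(mu, w)`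
already subtracted. -/
def deflationNoise (q : ℕ) (lam : Fin k → ℝ) (v : Fin k → V) (Ef : V → V) (I : Finset (Fin k))
    (σ : Fin k → Fin k) (mu : Fin k → ℝ) (w : Fin k → V) (u : V) : V :=
  Ef u + ∑ i ∈ I, ((lam (σ i) * inner ℝ (v (σ i)) u ^ q) • v (σ i) -
    (mu i * inner ℝ (w i) u ^ q) • w i)

/-- The pair `(mu, w)` approximates `(lam, v)` with precision `e`. -/
def IsApproxPair (e lam : ℝ) (v : V) (mu : ℝ) (w : V) : Prop :=
  ‖w‖ = 1 ∧ ‖v - w‖ ≤ e / lam ∧ |lam - mu| ≤ e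

variable {q : ℕ} {lam : Fin k → ℝ} {v : Fin k → V} {Ef : V → V} {I : Finset (Fin k)}
  {σ : Fin k → Fin k} {mu : Fin k → ℝ} {w : Fin k → V}

theorem norm_deflationNoise_le (hv : Orthonormal ℝ v) (hq : 1 ≤ q) (hlam : ∀ i, 0 < lam i)
    {e s B : ℝ} {u : V} (he : 0 ≤ e)
    (happ : ∀ i ∈ I, IsApproxPair e (lam (σ i)) (v (σ i)) (mu i) (w i))
    (hE : ‖Ef u‖ ≤ s) (hB0 : 0 ≤ B)
    (hB : ∀ i ∈ I, max |inner ℝ (v (σ i)) u| |inner ℝ (w i) u| ^ (q - 1) ≤ B) :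
    ‖deflationNoise q lam v Ef I σ mu w u‖ ≤ s + k * ((q + 2) * e * B * ‖u‖) := by
  refine (norm_add_le _ _).trans (add_le_add hE ?_)
  refine (norm_sum_le _ _).trans ?_
  calc _ ≤ ∑ i ∈ I, (q + 2) * e * B * ‖u‖ := by
        refine Finset.sum_le_sum fun i hi => ?_
        obtain ⟨h1, h2, h3⟩ := happ i hi
        refine (norm_rankOne_term_sub_le (hv.1 _) h1 (hlam _) h2 h3 hq).trans ?_
        have := hB i hi
        gcongr
    _ = I.card * ((q + 2) * e * B * ‖u‖) := by simp
    _ ≤ _ := by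
      have : I.card ≤ k := by simpa using Finset.card_le_univ I
      have : (I.card : ℝ) ≤ k := by exact_mod_cast this
      gcongr

/-- Lets bounds on inner products with the true components serve for the recovered ones. -/
theorem IsApproxPair.max_inner_le {e lam mu : ℝ} {v w u : V} {b : ℝ}
    (h : IsApproxPair e lam v mu w) (hb : |inner ℝ v u| ≤ b) :
    max |inner ℝ v u| |inner ℝ w u| ≤ b + e / lam * ‖u‖ := by
  have h0 : 0 ≤ e / lam * ‖u‖ := mul_nonneg ((norm_nonneg _).trans h.2.1) (norm_nonneg _)
  refine max_le (by linarith) ?_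
  have h1 : |inner ℝ (v - w) u| ≤ e / lam * ‖u‖ :=
    (abs_real_inner_le_norm _ _).trans (mul_le_mul_of_nonneg_right h.2.1 (norm_nonneg _))
  rw [inner_sub_left, abs_le] at h1
  rw [abs_le] at hb ⊢
  constructor <;> linarith [h1.1, h1.2, hb.1, hb.2]

theorem IsApproxPair.max_inner_le_norm {e lam mu : ℝ} {v w u : V}
    (h : IsApproxPair e lam v mu w) (hv : ‖v‖ = 1) :
    max |inner ℝ v u| |inner ℝ w u| ≤ ‖u‖ :=
  max_le (by simpa [hv] using abs_real_inner_le_norm v u)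
    (by simpa [h.1] using abs_real_inner_le_norm w u)

/-- The source of constants independent of the order: relative errors up to `1/p` survive a `p`-th
power at bounded cost. -/
theorem one_add_one_div_pow_le {p : ℕ} (hp : 0 < p) : (1 + 1 / (p : ℝ)) ^ p ≤ 3 := by
  have hp' : (0 : ℝ) < p := by exact_mod_cast hp
  calc (1 + 1 / (p : ℝ)) ^ p ≤ Real.exp (1 / p) ^ p := by
        gcongr
        linarith [Real.add_one_le_exp (1 / (p : ℝ))]
    _ = Real.exp 1 := by rw [← Real.exp_nat_mul]; congr 1; field_simp
    _ ≤ 3 := by linarith [Real.exp_one_lt_d9]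

variable {n : ℕ} {ε : ℝ}

/-- The consequences of the smallness of `ε` in the form in which they are used. -/
theorem smallness_consequences (hq : 2 ≤ q) (hk : 1 ≤ k) (hkn : k ≤ n) (hε : 0 < ε) {l : ℝ}
    (h : 100000 * ((q : ℝ) + 1) ^ 2 * k * √n ^ (q - 1) * ε ≤ l) :
    100000 * ((q : ℝ) + 1) * (k * ((q + 1) * ε)) * √k ≤ l ∧
      10000 * (k * ((q + 2) * (ε / (10 * √n)))) ≤ l ∧
      100000 * ((q : ℝ) + 1) * √k * (√n ^ (q - 1) * ε) ≤ l ∧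
      100000 * ((q : ℝ) + 1) ^ 2 * ε ≤ l := by
  have hn1 : (1 : ℝ) ≤ n := by exact_mod_cast hk.trans hkn
  have hk1 : (1 : ℝ) ≤ k := by exact_mod_cast hk
  have hsn : 1 ≤ √(n : ℝ) := Real.one_le_sqrt.2 hn1
  have hsk : 1 ≤ √(k : ℝ) := Real.one_le_sqrt.2 hk1
  have hskn : √(k : ℝ) ≤ √n := Real.sqrt_le_sqrt (by exact_mod_cast hkn)
  have hsqk : √(k : ℝ) * √k = k := Real.mul_self_sqrt (by linarith)
  have hskk : √(k : ℝ) ≤ k := by nlinarith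
  have hpow : √(n : ℝ) ≤ √n ^ (q - 1) := le_self_pow₀ hsn (by omega)
  have hq2 : (2 : ℝ) ≤ q := by exact_mod_cast hq
  set r := √(n : ℝ) ^ (q - 1)
  have hr1 : 1 ≤ r := hsn.trans hpow
  refine ⟨le_trans ?_ h, le_trans ?_ h, le_trans ?_ h, le_trans ?_ h⟩
  · calc _ = 100000 * ((q : ℝ) + 1) ^ 2 * k * √k * ε := by ring
      _ ≤ _ := by gcongr; exact hskn.trans hpow
  · have h1 : ε / (10 * √n) ≤ ε / 10 := by gcongr; linarith
    calc _ ≤ 10000 * (k * ((q + 2) * (ε / 10))) := by gcongr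
      _ = 1000 * ((q : ℝ) + 2) * k * 1 * ε := by ring
      _ ≤ _ := by
        gcongr
        · norm_num
        · nlinarith
  · calc _ = 100000 * ((q : ℝ) + 1) * √k * r * ε := by ring
      _ ≤ _ := by gcongr; nlinarith
  · calc _ = 100000 * ((q : ℝ) + 1) ^ 2 * 1 * 1 * ε := by ring
      _ ≤ _ := by gcongr

/-- Noise bound on the unit ball. -/
theorem norm_deflationNoise_le_of_norm_le_one (hv : Orthonormal ℝ v) (hq : 2 ≤ q) (hk : 1 ≤ k)
    (hkn : k ≤ n) (hε : 0 < ε)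
    (hlam : ∀ i, 0 < lam i)
    (hsmall : ∀ i, 100000 * ((q : ℝ) + 1) ^ 2 * k * √n ^ (q - 1) * ε ≤ lam i)
    (happ : ∀ i ∈ I, IsApproxPair (ε / (10 * √n)) (lam (σ i)) (v (σ i)) (mu i) (w i))
    (hE : ∀ u, ‖Ef u‖ ≤ ε / (100 * √n) * ‖u‖ ^ q) (j : Fin k) {u : V} (hu : ‖u‖ ≤ 1) :
    ‖deflationNoise q lam v Ef I σ mu w u‖ ≤ 1 / 3000 * lam j := by
  have hn1 : (1 : ℝ) ≤ n := by exact_mod_cast hk.trans hkn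
  have hsn : 1 ≤ √(n : ℝ) := Real.one_le_sqrt.2 hn1
  obtain ⟨-, h2, -, h4⟩ := smallness_consequences hq hk hkn hε (hsmall j)
  have h := norm_deflationNoise_le (q := q) hv (by omega) hlam (by positivity) happ (s := ε) (u := u) (B := 1)
    ((hE u).trans (by
      calc ε / (100 * √n) * ‖u‖ ^ q ≤ ε / 1 * 1 := by
            gcongr
            · linarith
            · exact pow_le_one₀ (norm_nonneg _) hu
        _ = ε := by ring)) zero_le_one fun i hi =>
      pow_le_one₀ (le_max_of_le_left (abs_nonneg _))
        (((happ i hi).max_inner_le_norm (hv.1 _)).trans hu)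
  have h5 : k * ((q + 2) * (ε / (10 * √n)) * 1 * ‖u‖) ≤ k * ((q + 2) * (ε / (10 * √n)) * 1 * 1) := by
    gcongr
  have hq0 : (0 : ℝ) ≤ q := Nat.cast_nonneg q
  have h6 : 100000 * 1 * ε ≤ 100000 * ((q : ℝ) + 1) ^ 2 * ε := by
    gcongr; nlinarith
  linarith

/-- Noise bound in the initial phase. -/
theorem norm_deflationNoise_le_of_isDominated (hv : Orthonormal ℝ v) (hq : 2 ≤ q) (hk : 1 ≤ k)
    (hkn : k ≤ n) (hε : 0 < ε)
    (hlam : ∀ i, 0 < lam i)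
    (hsmall : ∀ i, 100000 * ((q : ℝ) + 1) ^ 2 * k * √n ^ (q - 1) * ε ≤ lam i)
    (happ : ∀ i ∈ I, IsApproxPair (ε / (10 * √n)) (lam (σ i)) (v (σ i)) (mu i) (w i))
    (hE : ∀ u, ‖Ef u‖ ≤ ε / (100 * √n) * ‖u‖ ^ q) {j : Fin k} {x : V}
    (hx : IsDominated v j (n + 1 / ((q : ℝ) + 1)) 1 x) :
    ‖deflationNoise q lam v Ef I σ mu w x‖ ≤ 1 / (50000 * ((q : ℝ) + 1) * √k) * lam j := by
  have hn1 : (1 : ℝ) ≤ n := by exact_mod_cast hk.trans hkn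
  have hk1 : (1 : ℝ) ≤ k := by exact_mod_cast hk
  have hsn : 1 ≤ √(n : ℝ) := Real.one_le_sqrt.2 hn1
  have hsk : 1 ≤ √(k : ℝ) := Real.one_le_sqrt.2 hk1
  have hsn2 : √(n : ℝ) ^ 2 = n := Real.sq_sqrt (by linarith)
  have hq0 : (2 : ℝ) ≤ q := by exact_mod_cast hq
  have hinv : 1 / ((q : ℝ) + 1) ≤ 1 := by rw [div_le_one (by linarith)]; linarith
  have hthree : (1 + 1 / ((q : ℝ) + 1)) ^ (q + 1) ≤ 3 := by
    have := one_add_one_div_pow_le (Nat.succ_pos q)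
    push_cast at this
    exact this
  have hbase : 1 ≤ 1 + 1 / ((q : ℝ) + 1) := by
    have : 0 ≤ 1 / ((q : ℝ) + 1) := by positivity
    linarith
  have hxn : ‖x‖ ^ 2 ≤ (√n) ^ 2 * (1 + 1 / ((q : ℝ) + 1)) := by
    refine hx.2.2.trans ?_
    rw [hsn2]
    have : 1 * (1 / ((q : ℝ) + 1)) ≤ n * (1 / ((q : ℝ) + 1)) := by gcongr
    linarith
  have hx2 : ‖x‖ ≤ 3 / 2 * √n := by
    refine le_of_sq_le_sq ?_ (by positivity)
    nlinarith
  have hxq : ‖x‖ ^ q ≤ 2 * √n ^ q := by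
    refine le_of_sq_le_sq ?_ (by positivity)
    calc (‖x‖ ^ q) ^ 2 = (‖x‖ ^ 2) ^ q := by ring
      _ ≤ ((√n) ^ 2 * (1 + 1 / ((q : ℝ) + 1))) ^ q := by gcongr
      _ = (√n ^ q) ^ 2 * (1 + 1 / ((q : ℝ) + 1)) ^ q := by rw [mul_pow]; ring
      _ ≤ (√n ^ q) ^ 2 * 4 := by
        gcongr
        exact (pow_le_pow_right₀ hbase (Nat.le_succ q)).trans (hthree.trans (by norm_num))
      _ = _ := by ring
  have hxi : ∀ i, |inner ℝ (v i) x| ≤ 1 := fun i => by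
    by_cases h : i = j
    · rw [h, hx.1, abs_one]
    · exact hx.2.1 i h
  have h := norm_deflationNoise_le (q := q) hv (by omega) hlam (by positivity) happ (u := x)
    (s := 1 / 50 * (√n ^ (q - 1) * ε)) (B := 3) ((hE x).trans (by
      obtain ⟨r, rfl⟩ : ∃ r, q = r + 1 := ⟨q - 1, by omega⟩
      calc ε / (100 * √n) * ‖x‖ ^ (r + 1) ≤ ε / (100 * √n) * (2 * √n ^ (r + 1)) := by gcongr
        _ = _ := by rw [Nat.add_sub_cancel, pow_succ]; field_simp; norm_num)) (by norm_num)
    -- Inner products with `v (σ i)` are at most `1`. Passing to `w i` adds at most `1 / (q + 1)`,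
    -- so the powers stay below `3`.
    fun i hi => by
      have h1 := (happ i hi).max_inner_le (hxi (σ i))
      obtain ⟨-, -, -, h4⟩ := smallness_consequences hq hk hkn hε (hsmall (σ i))
      have h2 : ε / (10 * √n) / lam (σ i) * ‖x‖ ≤ 1 / ((q : ℝ) + 1) := by
        have hli := hlam (σ i)
        calc _ ≤ ε / (10 * √n) / lam (σ i) * (3 / 2 * √n) := by gcongr
          _ = 3 / 20 * ε / lam (σ i) := by field_simp; norm_num
          _ ≤ 1 / ((q : ℝ) + 1) := by
            rw [div_le_div_iff₀ hli (by linarith)]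
            nlinarith [mul_pos hε (by linarith : (0 : ℝ) < q)]
      calc _ ≤ (1 + 1 / ((q : ℝ) + 1)) ^ (q - 1) := by
            exact pow_le_pow_left₀ (le_max_of_le_left (abs_nonneg _)) (by linarith) _
        _ ≤ (1 + 1 / ((q : ℝ) + 1)) ^ (q + 1) := pow_le_pow_right₀ hbase (by omega)
        _ ≤ 3 := hthree
  obtain ⟨h1, -, h3, -⟩ := smallness_consequences hq hk hkn hε (hsmall j)
  refine h.trans ?_
  have h5 : k * ((q + 2) * (ε / (10 * √n)) * 3 * ‖x‖) ≤ k * ((q + 1) * ε) := by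
    calc k * ((q + 2) * (ε / (10 * √n)) * 3 * ‖x‖)
        ≤ k * ((q + 2) * (ε / (10 * √n)) * 3 * (3 / 2 * √n)) := by gcongr
      _ = k * ((9 / 20 * (q + 2)) * ε) := by field_simp; norm_num
      _ ≤ _ := by gcongr; linarith
  rw [one_div_mul_eq_div (50000 * ((q : ℝ) + 1) * √k), le_div_iff₀ (by positivity)]
  have h6 : 50000 * ((q : ℝ) + 1) * √k * (k * ((q + 2) * (ε / (10 * √n)) * 3 * ‖x‖)) ≤
      50000 * ((q : ℝ) + 1) * √k * (k * ((q + 1) * ε)) := by gcongr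
  have hlj := hlam j
  linarith

/-- Noise bound in the final phase. -/
theorem norm_deflationNoise_le_of_near (hv : Orthonormal ℝ v) (hq : 2 ≤ q) (hk : 1 ≤ k)
    (hkn : k ≤ n) (hε : 0 < ε)
    (hlam : ∀ i, 0 < lam i)
    (hsmall : ∀ i, 100000 * ((q : ℝ) + 1) ^ 2 * k * √n ^ (q - 1) * ε ≤ lam i)
    (happ : ∀ i ∈ I, IsApproxPair (ε / (10 * √n)) (lam (σ i)) (v (σ i)) (mu i) (w i))
    (hE : ∀ u, ‖Ef u‖ ≤ ε / (100 * √n) * ‖u‖ ^ q) {j : Fin k} (hj : ∀ i ∈ I, σ i ≠ j) {x : V}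
    (hx : inner ℝ (v j) x = 1) (hxt : (q + 1) * ‖x - v j‖ ^ 2 ≤ 1 / 100) :
    ‖deflationNoise q lam v Ef I σ mu w x‖
      ≤ 21 / 100 * (ε / (10 * √n)) + 1 / 100 * ‖x - v j‖ * lam j := by
  have hn1 : (1 : ℝ) ≤ n := by exact_mod_cast hk.trans hkn
  have hk1 : (1 : ℝ) ≤ k := by exact_mod_cast hk
  have hsn : 1 ≤ √(n : ℝ) := Real.one_le_sqrt.2 hn1
  have hq0 : (2 : ℝ) ≤ q := by exact_mod_cast hq
  set e := ε / (10 * √n) with he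
  have he0 : 0 < e := by positivity
  set t := ‖x - v j‖ with ht
  have ht0 : 0 ≤ t := norm_nonneg _
  have hxn : ‖x‖ ^ 2 ≤ 1 + 1 / ((q : ℝ) + 1) := by
    rw [norm_sq_eq_one_add hv hx, ← ht]
    have : t ^ 2 ≤ 1 / ((q : ℝ) + 1) := by
      rw [le_div_iff₀ (by linarith)]; linarith
    linarith
  have hthree : (1 + 1 / ((q : ℝ) + 1)) ^ (q + 1) ≤ 3 := by
    have := one_add_one_div_pow_le (Nat.succ_pos q)
    push_cast at this
    exact this
  have hbase : 1 ≤ 1 + 1 / ((q : ℝ) + 1) := by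
    have : 0 ≤ 1 / ((q : ℝ) + 1) := by positivity
    linarith
  have hpow : ∀ r, r ≤ q → ‖x‖ ^ r ≤ 2 := fun r hr => by
    refine le_of_sq_le_sq ?_ (by norm_num)
    calc (‖x‖ ^ r) ^ 2 = (‖x‖ ^ 2) ^ r := by ring
      _ ≤ (1 + 1 / ((q : ℝ) + 1)) ^ r := by gcongr
      _ ≤ (1 + 1 / ((q : ℝ) + 1)) ^ (q + 1) := pow_le_pow_right₀ hbase (by omega)
      _ ≤ _ := by linarith
  have hx2 : ‖x‖ ≤ 2 := by simpa using hpow 1 (by omega)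
  have hterm : ∀ i ∈ I,
      k * ((q + 2) * e * (max |inner ℝ (v (σ i)) x| |inner ℝ (w i) x| ^ (q - 1) * ‖x‖))
        ≤ 1 / 100 * t * lam j + 1 / 100 * e := by
    intro i hi
    have hli := hlam (σ i)
    -- As `σ i ≠ j`, only the deviation `x - v j` is seen by `v (σ i)`. This makes the deflation
    -- error shrink together with `t`.
    have h1 : |inner ℝ (v (σ i)) x| ≤ t := by
      have := hv.abs_inner_le_norm (σ i) (x - v j)
      rwa [inner_sub_right, orthonormal_iff_ite.1 hv, if_neg (hj i hi), sub_zero] at this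
    have h2 := (happ i hi).max_inner_le h1
    have h3 := (happ i hi).max_inner_le_norm (u := x) (hv.1 _)
    set m := max |inner ℝ (v (σ i)) x| |inner ℝ (w i) x|
    have hm0 : 0 ≤ m := le_max_of_le_left (abs_nonneg _)
    obtain ⟨-, hs, -, -⟩ := smallness_consequences hq hk hkn hε (hsmall (σ i))
    obtain ⟨-, hsj, -, -⟩ := smallness_consequences hq hk hkn hε (hsmall j)
    rw [← he] at hs hsj
    have hmt : m ≤ t + 2 * (e / lam (σ i)) := by
      have : e / lam (σ i) * ‖x‖ ≤ e / lam (σ i) * 2 := by gcongr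
      linarith
    have h4 : m ^ (q - 1) * ‖x‖ ≤ 2 * (t + 2 * (e / lam (σ i))) := by
      obtain ⟨r, rfl⟩ : ∃ r, q = r + 2 := ⟨q - 2, by omega⟩
      calc m ^ (r + 2 - 1) * ‖x‖ = m ^ r * m * ‖x‖ := by
            rw [show r + 2 - 1 = r + 1 by omega, pow_succ]
        _ ≤ ‖x‖ ^ r * (t + 2 * (e / lam (σ i))) * ‖x‖ := by gcongr
        _ = ‖x‖ ^ (r + 1) * (t + 2 * (e / lam (σ i))) := by ring
        _ ≤ _ := by gcongr; exact hpow _ (by omega)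
    -- The part not proportional to `t` is quadratic in `e`, hence negligible against `e` itself.
    have h5 : k * ((q + 2) * e) * (e / lam (σ i)) ≤ 1 / 10000 * e := by
      rw [← mul_div_assoc, div_le_iff₀ hli]
      nlinarith
    have h6 : t * (10000 * (k * ((q + 2) * e))) ≤ t * lam j := by gcongr
    have h7 : 0 ≤ t * lam j := mul_nonneg ht0 (hlam j).le
    calc k * ((q + 2) * e * (m ^ (q - 1) * ‖x‖))
        ≤ k * ((q + 2) * e * (2 * (t + 2 * (e / lam (σ i))))) := by gcongr
      _ = 2 * t * (k * ((q + 2) * e)) + 4 * (k * ((q + 2) * e) * (e / lam (σ i))) := by ring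
      _ ≤ _ := by linarith
  have hEx : ‖Ef x‖ ≤ 1 / 5 * e := (hE x).trans (by
    calc ε / (100 * √n) * ‖x‖ ^ q ≤ ε / (100 * √n) * 2 := by gcongr; exact hpow q le_rfl
      _ = _ := by rw [he]; field_simp; norm_num)
  have hlj := hlam j
  rcases I.eq_empty_or_nonempty with rfl | hI
  · have : deflationNoise q lam v Ef ∅ σ mu w x = Ef x := by simp [deflationNoise]
    rw [this]
    have : 0 ≤ 1 / 100 * t * lam j := by positivity
    linarith
  obtain ⟨i, hi, hmax⟩ := I.exists_max_image
    (fun i => max |inner ℝ (v (σ i)) x| |inner ℝ (w i) x| ^ (q - 1)) hI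
  have h := norm_deflationNoise_le (q := q) hv (by omega) hlam he0.le happ hEx
    (B := max |inner ℝ (v (σ i)) x| |inner ℝ (w i) x| ^ (q - 1))
    (pow_nonneg (le_max_of_le_left (abs_nonneg _)) _) hmax
  have h7 := hterm i hi
  rw [← mul_assoc ((q + 2) * e)] at h7
  linarith

end DeflationNoise

/-! ### One round of the method, and induction over the rounds -/

namespace PTensor

variable {q k n L : ℕ}

/-- A starting vector whose component along `v_j` exceeds the components along the other `v_i` by
the factor `1 + γ` and is at least of average size. -/
def IsGoodStart (v : Fin k → EuclideanSpace ℝ (Fin n)) (γ : ℝ) (j : Fin k)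
    (u : EuclideanSpace ℝ (Fin n)) : Prop :=
  inner ℝ (v j) u ≠ 0 ∧ (∀ i, i ≠ j → (1 + γ) * |inner ℝ (v i) u| ≤ |inner ℝ (v j) u|) ∧
    ‖u‖ ^ 2 ≤ n * inner ℝ (v j) u ^ 2

/-- The additive gap is half the multiplicative one because `1 ≤ (1 + γ) (1 - γ/2)` for `γ ≤ 1`. -/
theorem IsGoodStart.isDominated {v : Fin k → EuclideanSpace ℝ (Fin n)} {γ M : ℝ} {j : Fin k}
    {u : EuclideanSpace ℝ (Fin n)} (h : IsGoodStart v γ j u) (hγ0 : 0 ≤ γ) (hγ1 : γ ≤ 1)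
    (hM : n ≤ M) :
    IsDominated v j M (1 - γ / 2) ((inner ℝ (v j) u)⁻¹ • u) := by
  obtain ⟨h0, h1, h2⟩ := h
  refine ⟨by rw [inner_smul_right, inv_mul_cancel₀ h0], fun i hi => ?_, ?_⟩
  · rw [inner_smul_right, abs_mul, abs_inv, inv_mul_le_iff₀ (abs_pos.2 h0)]
    have h3 := h1 i hi
    have h4 := abs_nonneg (inner ℝ (v i) u)
    have h5 : 1 ≤ (1 + γ) * (1 - γ / 2) := by nlinarith
    have h6 : |inner ℝ (v i) u| * 1 ≤ |inner ℝ (v i) u| * ((1 + γ) * (1 - γ / 2)) := by gcongr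
    have h7 : (1 + γ) * |inner ℝ (v i) u| * (1 - γ / 2) ≤ |inner ℝ (v j) u| * (1 - γ / 2) :=
      mul_le_mul_of_nonneg_right h3 (by linarith)
    linarith
  · rw [norm_smul, mul_pow, norm_inv, Real.norm_eq_abs, inv_pow, sq_abs,
      inv_mul_le_iff₀ (by positivity)]
    nlinarith [mul_le_mul_of_nonneg_left hM (sq_nonneg (inner ℝ (v j) u))]

variable {lam : Fin k → ℝ} {v : Fin k → EuclideanSpace ℝ (Fin n)} {E : PTensor (q + 1) n}
  {I R : Finset (Fin k)} {σ : Fin k → Fin k} {mu : Fin k → ℝ}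
  {w : Fin k → EuclideanSpace ℝ (Fin n)} {ε : ℝ}

/-- The arithmetic at the end of the global phase, applied with `P` the order, `x = n` and `a` a
power of `4/5`: the number of steps makes `a` beat `P √M`, and the noise is below `1 / (50000 P)`.
-/
theorem mul_le_of_geometric_error {P K x X M a η t : ℝ} (hP : 3 ≤ P) (hK : 1 ≤ K) (hx : 1 ≤ x)
    (ha : 0 ≤ a) (haX : a * X ≤ 1) (hX : 100000 * (P * P * K * x) ≤ X) (hM : M ≤ x + 1)
    (hη : η * (50000 * P) ≤ 1) (ht : t ≤ a * √M + 10 * η) : P * t ≤ 1 / 1000 := by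
  have h2 : √M ≤ 2 * x := by
    rw [Real.sqrt_le_left (by linarith)]
    nlinarith
  have h3 : a * (100000 * (P * x)) ≤ 1 := by
    refine le_trans (mul_le_mul_of_nonneg_left ?_ ha) haX
    refine le_trans ?_ hX
    have h4 : 1 ≤ P * K := by nlinarith
    have h5 : 0 ≤ P * x := by positivity
    nlinarith
  have h4 : a * √M ≤ a * (2 * x) := by gcongr
  have h5 : P * t ≤ P * (a * (2 * x) + 10 * η) := by
    gcongr
    linarith
  linarith

/-- From a good starting vector, `T` iterations reach nearly the largest remaining value. -/
theorem le_value_powerIter (hv : Orthonormal ℝ v) (hq : 2 ≤ q) (hk : 1 ≤ k)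
    (hkn : k ≤ n) (hε : 0 < ε) (hlam : ∀ i, 0 < lam i)
    (hsmall : ∀ i, 100000 * ((q : ℝ) + 1) ^ 2 * k * √n ^ (q - 1) * ε ≤ lam i)
    (happ : ∀ i ∈ I, IsApproxPair (ε / (10 * √n)) (lam (σ i)) (v (σ i)) (mu i) (w i))
    (hE : ∀ u, ‖contract E u‖ ≤ ε / (100 * √n) * ‖u‖ ^ q)
    {A : PTensor (q + 1) n}
    (hA : contract A = perturbedPowerMap q lam v R
      (deflationNoise q lam v (contract E) I σ mu w))
    {T : ℕ} (hT : 100000 * ((q : ℝ) + 1) ^ 2 * k * n ≤ (5 / 4) ^ (T / 2))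
    {j : Fin k} (hj : j ∈ R) (hmax : ∀ i ∈ R, lam i ≤ lam j)
    {u : EuclideanSpace ℝ (Fin n)} (hu : IsGoodStart v (1 / (1000 * √k)) j u) :
    (1 - 1 / 1500) * lam j ≤ value A (powerIter A T u) := by
  have hn1 : (1 : ℝ) ≤ n := by exact_mod_cast hk.trans hkn
  have hk1 : (1 : ℝ) ≤ k := by exact_mod_cast hk
  have hsk : 1 ≤ √(k : ℝ) := Real.one_le_sqrt.2 hk1
  have hskk : √(k : ℝ) ≤ k := by
    have := Real.mul_self_sqrt (by linarith : (0 : ℝ) ≤ k)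
    nlinarith
  have hq0 : (2 : ℝ) ≤ q := by exact_mod_cast hq
  have hlj := hlam j
  set P : ℝ := (q : ℝ) + 1 with hP
  have hP3 : 3 ≤ P := by linarith
  set X : ℝ := (5 / 4) ^ (T / 2) with hX
  have hXbig : 100000 * (P * P * k * n) ≤ X := by
    calc _ = 100000 * P ^ 2 * k * n := by ring
      _ ≤ X := hT
  have hPk : 1 ≤ P * P * k * n := by
    calc (1 : ℝ) = 1 * 1 * 1 * 1 := by norm_num
      _ ≤ _ := by gcongr <;> linarith
  have hX1 : 100000 ≤ X := by linarith
  set N := deflationNoise q lam v (contract E) I σ mu w with hN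
  set η : ℝ := 1 / (50000 * P * √k) with hη
  have hη0 : 0 < η := by positivity
  have hηP : η ≤ 1 / (50000 * P) := by
    rw [hη]
    exact one_div_le_one_div_of_le (by positivity) (le_mul_of_one_le_right (by positivity) hsk)
  have hηP' : η * (50000 * P) ≤ 1 := by rwa [le_div_iff₀ (by positivity)] at hηP
  set M : ℝ := n + 1 / P with hM
  have hinv : 1 / P ≤ 1 := by rw [div_le_one (by linarith)]; linarith
  have hγ : 1 / (1000 * √(k : ℝ)) ≤ 1 / 1000 := by
    gcongr
    linarith
  have hdom := hu.isDominated (M := M) (by positivity) (by linarith)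
    (by rw [hM]; linarith [show 0 ≤ 1 / P by positivity])
  have hhalf : 1 / (1000 * √(k : ℝ)) / 2 = 1 / (2000 * √k) := by field_simp; norm_num
  rw [hhalf] at hdom
  have hdiv : T / 2 ≤ T - T / 2 := by omega
  have hT2 : 1 ≤ T / 2 := by
    by_contra h
    have : T / 2 = 0 := by omega
    rw [hX, this] at hX1
    norm_num at hX1
  have hFhom : ∀ (c : ℝ) (u : EuclideanSpace ℝ (Fin n)), perturbedPowerMap q lam v R N (c • u) =
      c ^ q • perturbedPowerMap q lam v R N u := fun c u => by
    rw [← hA]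
    exact contract_smul_vec (Nat.succ_pos q) A c u
  -- Half of the iterations widen the gap, the remaining ones approach `v j`. The term `1 / P` in
  -- `M` absorbs the `4 η²` of noise.
  obtain ⟨y, d, hy, hd, hyj, hyt, hnorm, hpos⟩ := exists_iterate_near (η := η) (M := M)
    (γ := 1 / (2000 * √k)) (m₁ := T / 2) (m₂ := T - T / 2) hv hq hj
    (fun i hi => ⟨hlam i, hmax i hi⟩) hη0.le
    (hηP.trans (by rw [div_le_div_iff₀ (by positivity) (by norm_num)]; linarith))
    (by
      rw [hη, mul_one_div, div_le_div_iff₀ (by positivity) (by positivity)]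
      have : 1 * √(k : ℝ) ≤ P * √k := by gcongr; linarith
      linarith)
    (by positivity) (by rw [← hhalf]; linarith)
    (by
      have h1 : 4 * η ^ 2 ≤ 1 / P := by
        rw [le_div_iff₀ (by linarith)]
        have : η * P ≤ 1 / 50000 := by linarith
        have h2 : η ≤ 1 := by nlinarith
        nlinarith
      have : (k : ℝ) ≤ n := by exact_mod_cast hkn
      rw [hM]; linarith)
    hFhom
    (fun x hx => norm_deflationNoise_le_of_isDominated hv hq hk hkn hε hlam hsmall happ hE hx)
    (c := inner ℝ (v j) u) hu.1 hdom
    (by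
      have h1 : X ≤ (3 / 2) ^ (T / 2) :=
        pow_le_pow_left₀ (by norm_num) (by norm_num) _
      have h2 : 500 * √(k : ℝ) ≤ X := by
        have : 1 * √(k : ℝ) ≤ P * P * n * k := by
          gcongr
          calc (1 : ℝ) = 1 * 1 * 1 := by norm_num
            _ ≤ _ := by gcongr <;> linarith
        linarith
      rw [one_div_mul_eq_div, div_le_div_iff₀ (by norm_num) (by positivity)]
      linarith)
    (hT2.trans hdiv)
  have hTT : T - T / 2 + T / 2 = T := by omega
  rw [hTT, smul_smul, mul_inv_cancel₀ hu.1, one_smul, ← hA] at hy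
  have hyw : powerIter A T u = d • y := hy
  rw [hyw, value_eq_inner (Nat.succ_pos q), hA]
  have hval := abs_inner_perturbedPowerMap_self_sub_le (N := N) hv hq hj
    (fun i hi => ⟨hlam i, (hmax i hi).trans (by linarith)⟩) hyj hnorm hpos
  have hnoise := norm_deflationNoise_le_of_norm_le_one hv hq hk hkn hε hlam hsmall happ hE j
    hnorm.le
  have ht : P * ‖y - v j‖ ≤ 1 / 1000 := by
    have h1 : (4 / 5 : ℝ) ^ (T - T / 2) * X ≤ 1 := by
      have h2 : (4 / 5 : ℝ) ^ (T - T / 2) ≤ (4 / 5) ^ (T / 2) :=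
        pow_le_pow_of_le_one (by norm_num) (by norm_num) hdiv
      refine (mul_le_mul_of_nonneg_right h2 (by linarith)).trans_eq ?_
      rw [hX, ← mul_pow]
      norm_num
    exact mul_le_of_geometric_error hP3 hk1 hn1 (by positivity) h1 hXbig (by linarith) hηP' hyt
  have ht2 : (q + 3) * lam j * ‖y - v j‖ ^ 2 ≤ 1 / 3000 * lam j := by
    have h1 : ((q : ℝ) + 3) * ‖y - v j‖ ^ 2 ≤ 1 / 3000 := by
      have h0 := norm_nonneg (y - v j)
      have h2 : 3 * ‖y - v j‖ ≤ P * ‖y - v j‖ := by gcongr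
      have h3 : ((q : ℝ) + 3) * ‖y - v j‖ ≤ 1 / 500 := by linarith
      nlinarith
    calc _ = (((q : ℝ) + 3) * ‖y - v j‖ ^ 2) * lam j := by ring
      _ ≤ _ := by gcongr
  have := (abs_le.1 hval).1
  linarith

/-- `4^T` dominates the square of `(5/4)^(T/2)`: one factor pays for the constant `20`, the other
for `l n / ε`. -/
theorem one_fourth_pow_le {T : ℕ} {l : ℝ} (hn : (1 : ℝ) ≤ n) (hε : 0 < ε) (hl : 0 < l)
    (hX : 100000 ≤ (5 / 4 : ℝ) ^ (T / 2)) (hT : l * n / ε ≤ (5 / 4) ^ (T / 2)) :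
    (1 / 4 : ℝ) ^ T ≤ ε / (10 * √n) / l / 2 := by
  have hsn : 1 ≤ √(n : ℝ) := Real.one_le_sqrt.2 hn
  have h1 : ((5 / 4 : ℝ) ^ (T / 2)) ^ 2 ≤ 4 ^ T := by
    rw [← pow_mul]
    calc (5 / 4 : ℝ) ^ (T / 2 * 2) ≤ 4 ^ (T / 2 * 2) := by gcongr; norm_num
      _ ≤ 4 ^ T := pow_le_pow_right₀ (by norm_num) (by omega)
  have h2 : 20 * (l * n / ε) ≤ 4 ^ T := by
    refine le_trans ?_ h1
    rw [sq]
    exact mul_le_mul (by linarith) hT (by positivity) (by positivity)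
  have h3 : √(n : ℝ) ≤ n := by
    have := Real.mul_self_sqrt (by linarith : (0 : ℝ) ≤ n)
    nlinarith
  have h5 : 20 * (l * √n / ε) ≤ 4 ^ T := by
    refine le_trans ?_ h2
    gcongr
  rw [one_div, inv_pow, inv_le_comm₀ (by positivity) (by positivity)]
  refine le_trans (le_of_eq ?_) h5
  field_simp
  norm_num

/-- The value at a recovered vector is precise. -/
theorem abs_sub_value_le (hv : Orthonormal ℝ v) (hq : 2 ≤ q) (hk : 1 ≤ k)
    (hkn : k ≤ n) (hε : 0 < ε) (hlam : ∀ i, 0 < lam i)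
    {A : PTensor (q + 1) n}
    (hA : contract A = perturbedPowerMap q lam v R
      (deflationNoise q lam v (contract E) I σ mu w))
    {j : Fin k} (hj : j ∈ R) (hlamR : ∀ i ∈ R, 0 < lam i ∧ lam i ≤ 2 * lam j)
    (hδ : 100000 * ((q : ℝ) + 1) ^ 2 * (ε / (10 * √n) / lam j) ≤ 1)
    {y : EuclideanSpace ℝ (Fin n)} {d : ℝ}
    (hNy' : ‖deflationNoise q lam v (contract E) I σ mu w y‖ ≤
      (21 / 100 * (ε / (10 * √n) / lam j) + 1 / 100 * ‖y - v j‖) * lam j)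
    (hyj : inner ℝ (v j) y = 1) (hyt : ‖y - v j‖ ≤ ε / (10 * √n) / lam j) (hnorm : ‖d • y‖ = 1)
    (hpos : Even q → 0 < d) :
    |lam j - value A (d • y)| ≤ ε / (10 * √n) := by
  have hn1 : (1 : ℝ) ≤ n := by exact_mod_cast hk.trans hkn
  have hsn : 1 ≤ √(n : ℝ) := Real.one_le_sqrt.2 hn1
  have hk1 : (1 : ℝ) ≤ k := by exact_mod_cast hk
  have hq0 : (2 : ℝ) ≤ q := by exact_mod_cast hq
  set N := deflationNoise q lam v (contract E) I σ mu w with hN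
  have hFhom : ∀ (c : ℝ) (u : EuclideanSpace ℝ (Fin n)), perturbedPowerMap q lam v R N (c • u) =
      c ^ q • perturbedPowerMap q lam v R N u := fun c u => by
    rw [← hA]
    exact contract_smul_vec (Nat.succ_pos q) A c u
  set e := ε / (10 * √n) with he
  have he0 : 0 < e := by positivity
  have hlj := hlam j
  have hδ0 : 0 < e / lam j := by positivity
  have h1 := abs_inner_perturbedPowerMap_self_sub_le (N := N) hv hq hj hlamR hyj hnorm hpos
  rw [value_eq_inner (Nat.succ_pos q), hA, abs_sub_comm]
  refine h1.trans ?_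
  have hd1 : |d| ≤ 1 := by
    rw [norm_smul, Real.norm_eq_abs] at hnorm
    have h2 : 1 ≤ ‖y‖ := by simpa [hyj] using hv.abs_inner_le_norm j y
    calc |d| = |d| * 1 := (mul_one _).symm
      _ ≤ |d| * ‖y‖ := by gcongr
      _ = 1 := hnorm
  -- Homogeneity of the noise follows from that of the whole map by cancelling the orthogonal part.
  have hNd : N (d • y) = d ^ q • N y := by
    have h2 := hFhom d y
    simp only [perturbedPowerMap, smul_add, Finset.smul_sum, smul_smul, inner_smul_right,
      mul_pow] at h2
    have h3 : ∀ i, lam i * (d ^ q * inner ℝ (v i) y ^ q) = d ^ q * (lam i * inner ℝ (v i) y ^ q) :=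
      fun i => by ring
    simp only [h3] at h2
    exact add_left_cancel h2
  have hNy : ‖N (d • y)‖ ≤ ‖N y‖ := by
    rw [hNd, norm_smul, norm_pow, Real.norm_eq_abs]
    exact mul_le_of_le_one_left (norm_nonneg _) (pow_le_one₀ (abs_nonneg _) hd1)
  have h5 : ‖N y‖ ≤ 22 / 100 * e := by
    refine hNy'.trans ?_
    calc _ ≤ (21 / 100 * (e / lam j) + 1 / 100 * (e / lam j)) * lam j := by gcongr
      _ = 22 / 100 * e := by field_simp; norm_num
  have h6 : (q + 3) * lam j * ‖y - v j‖ ^ 2 ≤ 1 / 100 * e := by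
    calc _ ≤ (q + 3) * lam j * (e / lam j) ^ 2 := by gcongr
      _ = ((q + 3) * (e / lam j)) * e := by field_simp
      _ ≤ _ := by
        gcongr
        nlinarith
  linarith

/-- From the neighbourhood of a remaining component, `T` iterations reach full precision. -/
theorem isApproxPair_powerIter (hv : Orthonormal ℝ v) (hq : 2 ≤ q) (hk : 1 ≤ k)
    (hkn : k ≤ n) (hε : 0 < ε) (hlam : ∀ i, 0 < lam i)
    (hsmall : ∀ i, 100000 * ((q : ℝ) + 1) ^ 2 * k * √n ^ (q - 1) * ε ≤ lam i)
    (happ : ∀ i ∈ I, IsApproxPair (ε / (10 * √n)) (lam (σ i)) (v (σ i)) (mu i) (w i))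
    (hE : ∀ u, ‖contract E u‖ ≤ ε / (100 * √n) * ‖u‖ ^ q)
    {A : PTensor (q + 1) n}
    (hA : contract A = perturbedPowerMap q lam v R
      (deflationNoise q lam v (contract E) I σ mu w))
    {j : Fin k} (hj : j ∈ R) (hσj : ∀ i ∈ I, σ i ≠ j)
    (hlamR : ∀ i ∈ R, 0 < lam i ∧ lam i ≤ 2 * lam j) {T : ℕ} (hT1 : 1 ≤ T)
    (hX1 : 100000 ≤ (5 / 4 : ℝ) ^ (T / 2)) (hT : lam j * n / ε ≤ (5 / 4) ^ (T / 2))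
    {u : EuclideanSpace ℝ (Fin n)} (huj : inner ℝ (v j) u ≠ 0)
    (hjt : (q + 1) * ‖(inner ℝ (v j) u)⁻¹ • u - v j‖ ^ 2 ≤ 1 / 100) :
    ∃ s : ℝ, (s = 1 ∨ (Even (q + 1) ∧ s = -1)) ∧
      IsApproxPair (ε / (10 * √n)) (lam j) (v j) (value A (powerIter A T u))
        (s • powerIter A T u) := by
  have hn1 : (1 : ℝ) ≤ n := by exact_mod_cast hk.trans hkn
  have hsn : 1 ≤ √(n : ℝ) := Real.one_le_sqrt.2 hn1
  have hk1 : (1 : ℝ) ≤ k := by exact_mod_cast hk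
  have hq0 : (2 : ℝ) ≤ q := by exact_mod_cast hq
  set N := deflationNoise q lam v (contract E) I σ mu w with hN
  have hFhom : ∀ (c : ℝ) (u : EuclideanSpace ℝ (Fin n)), perturbedPowerMap q lam v R N (c • u) =
      c ^ q • perturbedPowerMap q lam v R N u := fun c u => by
    rw [← hA]
    exact contract_smul_vec (Nat.succ_pos q) A c u
  have hlj := hlam j
  set e := ε / (10 * √n) with he
  have he0 : 0 < e := by positivity
  obtain ⟨-, -, -, h4⟩ := smallness_consequences hq hk hkn hε (hsmall j)
  have heε : e ≤ ε := div_le_self hε.le (by linarith)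
  have hδ : 100000 * ((q : ℝ) + 1) ^ 2 * (e / lam j) ≤ 1 := by
    rw [← mul_div_assoc, div_le_one hlj]
    refine le_trans ?_ h4
    gcongr
  have hδ0 : 0 < e / lam j := by positivity
  -- The radius at which `(q + 1) τ² = 1/100`, the region where the final noise bound applies.
  set τ := 1 / (10 * √((q : ℝ) + 1)) with hτ
  have hsq3 : 17 / 10 ≤ √((q : ℝ) + 1) := Real.le_sqrt_of_sq_le (by norm_num; linarith)
  have hτ2 : ((q : ℝ) + 1) * τ ^ 2 = 1 / 100 := by
    rw [hτ, div_pow, mul_pow, Real.sq_sqrt (by linarith)]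
    field_simp
    norm_num
  have hτ0 : 0 < τ := by positivity
  have hle_τ : ∀ t : ℝ, 0 ≤ t → ((q : ℝ) + 1) * t ^ 2 ≤ 1 / 100 → t ≤ τ := fun t ht h => by
    refine le_of_sq_le_sq ?_ hτ0.le
    rw [← hτ2] at h
    exact le_of_mul_le_mul_left h (by linarith)
  have hNnear : ∀ x, inner ℝ (v j) x = 1 → ‖x - v j‖ ≤ τ →
      ‖N x‖ ≤ (21 / 100 * (e / lam j) + 1 / 100 * ‖x - v j‖) * lam j := fun x hx hxt => by
    have h1 := norm_deflationNoise_le_of_near hv hq hk hkn hε hlam hsmall happ hE hσj hx (by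
      rw [← hτ2]; gcongr)
    refine h1.trans (le_of_eq ?_)
    rw [add_mul, mul_assoc (21 / 100), div_mul_cancel₀ _ hlj.ne']
  have hδτ : e / lam j ≤ τ := hle_τ _ hδ0.le (by
    have : e / lam j ≤ 1 / 100 := by nlinarith
    nlinarith)
  obtain ⟨y, d, hy, hd, hyj, hyt, hnorm, hpos⟩ := exists_iterate_close (δ := e / lam j) (τ := τ)
    (m := T) hv hq hj hlamR hδ0.le hδτ
    (by rw [hτ, div_le_div_iff₀ (by positivity) (by norm_num)]; linarith) hFhom hNnear
    (c := inner ℝ (v j) u) huj (by rw [inner_smul_right, inv_mul_cancel₀ huj])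
    (hle_τ _ (norm_nonneg _) hjt) hT1 (one_fourth_pow_le hn1 hε hlj hX1 hT)
  rw [smul_smul, mul_inv_cancel₀ huj, one_smul, ← hA] at hy
  have hyw : powerIter A T u = d • y := hy
  rw [hyw]
  have hclose := abs_sub_value_le hv hq hk hkn hε hlam hA hj hlamR hδ
    (hNnear y hyj (hyt.trans hδτ)) hyj hyt hnorm hpos
  -- A negative scale can survive only for odd `q`, that is, even order, where the sign is
  -- immaterial.
  rcases lt_or_gt_of_ne hd with hneg | hdpos
  · have hodd : Even (q + 1) := by
      rcases Nat.even_or_odd q with h | h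
      · exact absurd (hpos h) (not_lt.2 hneg.le)
      · exact Odd.add_odd h odd_one
    refine ⟨-1, Or.inr ⟨hodd, rfl⟩, ?_, ?_, hclose⟩
    · rw [norm_smul, hnorm]; simp
    · rw [smul_smul]
      refine (norm_sub_le_of_normalized (hv.1 j) hyj ?_ (by linarith)).trans hyt
      rw [← smul_smul, norm_smul, hnorm]; simp
  · refine ⟨1, Or.inl rfl, ?_, ?_, hclose⟩
    · rw [one_smul, hnorm]
    · rw [one_smul]
      exact (norm_sub_le_of_normalized (hv.1 j) hyj hnorm hdpos).trans hyt

/-- One round of the power method recovers one of the remaining components. -/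
theorem IsPowerMethodOutput.exists_isApproxPair (hv : Orthonormal ℝ v) (hq : 2 ≤ q) (hk : 1 ≤ k)
    (hkn : k ≤ n) (hε : 0 < ε) (hlam : ∀ i, 0 < lam i)
    (hsmall : ∀ i, 100000 * ((q : ℝ) + 1) ^ 2 * k * √n ^ (q - 1) * ε ≤ lam i)
    (happ : ∀ i ∈ I, IsApproxPair (ε / (10 * √n)) (lam (σ i)) (v (σ i)) (mu i) (w i))
    (hE : ∀ u, ‖contract E u‖ ≤ ε / (100 * √n) * ‖u‖ ^ q)
    {A : PTensor (q + 1) n}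
    (hA : contract A = perturbedPowerMap q lam v R
      (deflationNoise q lam v (contract E) I σ mu w))
    (hR : R.Nonempty) (hσR : ∀ i ∈ I, σ i ∉ R)
    {T : ℕ} (hT : 100000 * ((q : ℝ) + 1) ^ 2 * k * n ≤ (5 / 4) ^ (T / 2))
    (hT' : ∀ i, lam i * n / ε ≤ (5 / 4) ^ (T / 2))
    {start : Fin L → EuclideanSpace ℝ (Fin n)}
    (hgood : ∀ j, ∃ l, IsGoodStart v (1 / (1000 * √k)) j (start l))
    {mu' : ℝ} {w' : EuclideanSpace ℝ (Fin n)} (hout : IsPowerMethodOutput A start T mu' w') :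
    ∃ j ∈ R, ∃ s : ℝ, (s = 1 ∨ (Even (q + 1) ∧ s = -1)) ∧
      IsApproxPair (ε / (10 * √n)) (lam j) (v j) mu' (s • w') := by
  have hn1 : (1 : ℝ) ≤ n := by exact_mod_cast hk.trans hkn
  have hsn : 1 ≤ √(n : ℝ) := Real.one_le_sqrt.2 hn1
  have hk1 : (1 : ℝ) ≤ k := by exact_mod_cast hk
  have hq0 : (2 : ℝ) ≤ q := by exact_mod_cast hq
  obtain ⟨l, hl, hw', hmu'⟩ := hout
  obtain ⟨j₀, hj₀, hmax⟩ := R.exists_max_image lam hR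
  obtain ⟨l₀, hl₀⟩ := hgood j₀
  have hval := (le_value_powerIter hv hq hk hkn hε hlam hsmall happ hE hA hT hj₀ hmax hl₀).trans
    (hl l₀)
  set u := powerIter A T (start l) with hu
  have hX1 : (100000 : ℝ) ≤ (5 / 4) ^ (T / 2) := by
    refine le_trans ?_ hT
    calc (100000 : ℝ) = 100000 * 1 * 1 * 1 := by norm_num
      _ ≤ _ := by
        gcongr
        nlinarith
  have hT1 : 1 ≤ T := by
    by_contra h
    have : T / 2 = 0 := by omega
    rw [this] at hX1
    norm_num at hX1
  -- Only an inequality: the selected trajectory is not controlled and might have collapsed to `0`.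
  have hu1 : ‖u‖ ≤ 1 := by
    obtain ⟨T', rfl⟩ : ∃ m, T = m + 1 := ⟨T - 1, by omega⟩
    rw [hu, powerIter, Function.iterate_succ_apply', powerStep, norm_smul, norm_inv, norm_norm]
    exact inv_mul_le_one
  rw [value_eq_inner (Nat.succ_pos q), hA] at hval
  obtain ⟨j, hj, huj, hlj₀, hjt⟩ := exists_near_of_large_value hv hq hj₀
    (fun i hi => ⟨hlam i, hmax i hi⟩) hu1
    ((norm_deflationNoise_le_of_norm_le_one hv hq hk hkn hε hlam hsmall happ hE j₀ hu1).trans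
      (by linarith [hlam j₀])) hval
  obtain ⟨s, hs, hs'⟩ := isApproxPair_powerIter hv hq hk hkn hε hlam hsmall happ hE hA hj
    (fun i hi h => hσR i hi (h ▸ hj)) (fun i hi => ⟨hlam i, (hmax i hi).trans hlj₀⟩) hT1 hX1
    (hT' j) huj hjt
  rw [← hw', ← hmu'] at hs'
  exact ⟨j, hj, s, hs, hs'⟩

/-- The contraction of a deflated tensor is a perturbed power map on the remaining components. -/
theorem contract_deflate (r : Fin k)
    (hσ : Set.InjOn σ (Finset.Iio r : Set (Fin k)))
    {wHat : Fin k → EuclideanSpace ℝ (Fin n)}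
    (hw : ∀ i ∈ Finset.Iio r, rankOne (q + 1) (wHat i) = rankOne (q + 1) (w i)) :
    contract (deflate ((∑ i, lam i • rankOne (q + 1) (v i)) + E) mu wHat r) =
      perturbedPowerMap q lam v (Finset.univ \ (Finset.Iio r).image σ)
        (deflationNoise q lam v (contract E) (Finset.Iio r) σ mu w) := by
  funext u
  have hsum : ∑ i ∈ Finset.Iio r, mu i • rankOne (q + 1) (wHat i) =
      ∑ i ∈ Finset.Iio r, mu i • rankOne (q + 1) (w i) :=
    Finset.sum_congr rfl fun i hi => by rw [hw i hi]
  rw [deflate, hsum]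
  have hone : ∀ x : EuclideanSpace ℝ (Fin n),
      contract (rankOne (q + 1) x) u = inner ℝ x u ^ q • x :=
    fun x => contract_rankOne (Nat.succ_pos q) x u
  simp only [contract_sub, contract_add, contract_sum, contract_smul, hone, perturbedPowerMap,
    deflationNoise, smul_smul, Finset.sum_sub_distrib]
  rw [← Finset.sum_image (f := fun i => (lam i * inner ℝ (v i) u ^ q) • v i) hσ,
    ← Finset.sum_sdiff (Finset.subset_univ ((Finset.Iio r).image σ))]
  abel

/-- With a good starting vector for every component in every round, the power method with deflation
recovers all components. -/
theorem IsDeflationOutput.exists_perm (hv : Orthonormal ℝ v) (hq : 2 ≤ q) (hk : 1 ≤ k)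
    (hkn : k ≤ n) (hε : 0 < ε) (hlam : ∀ i, 0 < lam i)
    (hsmall : ∀ i, 100000 * ((q : ℝ) + 1) ^ 2 * k * √n ^ (q - 1) * ε ≤ lam i)
    (hE : ∀ u, ‖contract E u‖ ≤ ε / (100 * √n) * ‖u‖ ^ q)
    {T : ℕ} (hT : 100000 * ((q : ℝ) + 1) ^ 2 * k * n ≤ (5 / 4) ^ (T / 2))
    (hT' : ∀ i, lam i * n / ε ≤ (5 / 4) ^ (T / 2))
    {start : Fin k → Fin L → EuclideanSpace ℝ (Fin n)}
    (hgood : ∀ r j, ∃ l, IsGoodStart v (1 / (1000 * √k)) j (start r l))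
    {wHat : Fin k → EuclideanSpace ℝ (Fin n)}
    (hout : IsDeflationOutput ((∑ i, lam i • rankOne (q + 1) (v i)) + E) start T mu wHat) :
    ∃ π : Equiv.Perm (Fin k), ∀ i, |lam i - mu (π i)| ≤ ε ∧
      (‖v i - wHat (π i)‖ ≤ ε / lam i ∨ (Even (q + 1) ∧ ‖v i + wHat (π i)‖ ≤ ε / lam i)) := by
  -- `σ` records which component each round found, `s` the sign that aligns the output with it. For
  -- even order the sign leaves the subtracted tensor unchanged.
  have key : ∀ m : ℕ, m ≤ k → ∃ (σ : Fin k → Fin k) (s : Fin k → ℝ),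
      Set.InjOn σ {r | (r : ℕ) < m} ∧ ∀ r : Fin k, (r : ℕ) < m →
        (s r = 1 ∨ (Even (q + 1) ∧ s r = -1)) ∧
        IsApproxPair (ε / (10 * √n)) (lam (σ r)) (v (σ r)) (mu r) (s r • wHat r) := by
    intro m
    induction m with
    | zero => exact fun _ => ⟨id, 1, fun r hr => absurd hr (Nat.not_lt_zero _),
        fun r hr => absurd hr (Nat.not_lt_zero _)⟩
    | succ m ih =>
      intro hm
      obtain ⟨σ, s, hσ, happ⟩ := ih (by omega)
      set r : Fin k := ⟨m, hm⟩ with hr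
      have hIio : ∀ i ∈ Finset.Iio r, (i : ℕ) < m := fun i hi =>
        Fin.lt_def.1 (Finset.mem_Iio.1 hi)
      have hσ' : Set.InjOn σ (Finset.Iio r : Set (Fin k)) :=
        hσ.mono fun i hi => hIio i (by simpa using hi)
      have hrank : ∀ i ∈ Finset.Iio r,
          rankOne (q + 1) (wHat i) = rankOne (q + 1) (s i • wHat i) := fun i hi => by
        rcases (happ i (hIio i hi)).1 with h | ⟨hp, h⟩
        · rw [h, one_smul]
        · rw [h, neg_one_smul, rankOne_neg hp]
      have hRne : (Finset.univ \ (Finset.Iio r).image σ).Nonempty := by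
        rw [← Finset.card_pos, Finset.card_sdiff_of_subset (Finset.subset_univ _)]
        have h1 : ((Finset.Iio r).image σ).card ≤ m :=
          Finset.card_image_le.trans (by simp [hr])
        rw [Finset.card_univ, Fintype.card_fin]
        omega
      obtain ⟨j, hj, s', hs', hj'⟩ := (hout r).exists_isApproxPair (σ := σ)
        (I := Finset.Iio r) (R := Finset.univ \ (Finset.Iio r).image σ)
        (w := fun i => s i • wHat i) hv hq hk hkn hε hlam hsmall
        (fun i hi => (happ i (hIio i hi)).2) hE (contract_deflate r hσ' hrank) hRne
        (fun i hi h => (Finset.mem_sdiff.1 h).2 (Finset.mem_image_of_mem σ hi)) hT hT' (hgood r)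
      have hjσ : ∀ i : Fin k, (i : ℕ) < m → σ i ≠ j := fun i hi h => by
        refine (Finset.mem_sdiff.1 hj).2 (Finset.mem_image.2 ⟨i, Finset.mem_Iio.2 (Fin.lt_def.2 hi), h⟩)
      refine ⟨Function.update σ r j, Function.update s r s', ?_, fun i hi => ?_⟩
      · intro a ha b hb hab
        have ha' : a = r ∨ (a : ℕ) < m := by
          rcases Nat.lt_succ_iff_lt_or_eq.1 ha with h | h
          · exact Or.inr h
          · exact Or.inl (Fin.ext h)
        have hb' : b = r ∨ (b : ℕ) < m := by
          rcases Nat.lt_succ_iff_lt_or_eq.1 hb with h | h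
          · exact Or.inr h
          · exact Or.inl (Fin.ext h)
        have hne : ∀ c : Fin k, (c : ℕ) < m → c ≠ r := fun c hc h => by
          rw [h] at hc; exact lt_irrefl _ hc
        rcases ha' with rfl | ha' <;> rcases hb' with rfl | hb'
        · rfl
        · rw [Function.update_self, Function.update_of_ne (hne b hb')] at hab
          exact absurd hab.symm (hjσ b hb')
        · rw [Function.update_self, Function.update_of_ne (hne a ha')] at hab
          exact absurd hab (hjσ a ha')
        · rw [Function.update_of_ne (hne a ha'), Function.update_of_ne (hne b hb')] at hab
          exact hσ ha' hb' hab
      · by_cases h : i = r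
        · subst h
          simp only [Function.update_self]
          exact ⟨hs', hj'⟩
        · rw [Function.update_of_ne h, Function.update_of_ne h]
          refine happ i ?_
          have : (i : ℕ) ≠ m := fun h' => h (Fin.ext h')
          omega
  obtain ⟨σ, s, hσ, happ⟩ := key k le_rfl
  have hinj : Function.Injective σ := fun a b hab => hσ a.isLt b.isLt hab
  have hn1 : (1 : ℝ) ≤ n := by exact_mod_cast hk.trans hkn
  have hsn : 1 ≤ √(n : ℝ) := Real.one_le_sqrt.2 hn1
  have heε : ε / (10 * √n) ≤ ε := div_le_self hε.le (by linarith)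
  set π : Equiv.Perm (Fin k) := Equiv.ofBijective σ (Finite.injective_iff_bijective.1 hinj)
  -- `π` sends rounds to components; the claim asks for the round of each component.
  refine ⟨π.symm, fun i => ?_⟩
  obtain ⟨r, rfl⟩ := π.surjective i
  rw [Equiv.symm_apply_apply]
  obtain ⟨hs, -, h2, h3⟩ := happ r r.isLt
  have hli : 0 < lam (π r) := hlam _
  have hd : ε / (10 * √n) / lam (π r) ≤ ε / lam (π r) := by gcongr
  refine ⟨h3.trans heε, ?_⟩
  rcases hs with h | ⟨hp, h⟩
  · left
    rw [h, one_smul] at h2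
    exact h2.trans hd
  · right
    rw [h, neg_one_smul, sub_neg_eq_add] at h2
    exact ⟨hp, h2.trans hd⟩

end PTensor

/-! ### Gaussian moments, and the probability of a gap above the other coordinates -/

section GaussianEstimates

open scoped ENNReal NNReal

theorem lintegral_sq_gaussianReal : ∫⁻ t, ENNReal.ofReal (t ^ 2) ∂(gaussianReal 0 1) = 1 := by
  have hint : Integrable (fun t : ℝ => t ^ 2) (gaussianReal 0 1) :=
    (memLp_id_gaussianReal (μ := 0) (v := 1) 2).integrable_sq
  rw [← ofReal_integral_eq_lintegral_ofReal hint (ae_of_all _ fun t => sq_nonneg t)]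
  have h1 := variance_fun_id_gaussianReal (μ := 0) (v := 1)
  rw [variance_of_integral_eq_zero (by fun_prop) integral_id_gaussianReal] at h1
  simp [h1]

/-- From `t⁴ ≤ 24 exp |t| ≤ 24 (exp t + exp (-t))` and the moment generating function: `48 √e ≤ 80`.
-/
theorem lintegral_pow_four_gaussianReal_le :
    ∫⁻ t, ENNReal.ofReal (t ^ 4) ∂(gaussianReal 0 1) ≤ 80 := by
  have hexp : ∀ c : ℝ, ∫ t, Real.exp (c * t) ∂(gaussianReal 0 1) = Real.exp (c ^ 2 / 2) := fun c => by
    have := congrFun (mgf_fun_id_gaussianReal (μ := 0) (v := 1)) c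
    simpa [mgf] using this
  have hint : ∀ c : ℝ, Integrable (fun t => Real.exp (c * t)) (gaussianReal 0 1) :=
    fun c => integrable_exp_mul_gaussianReal c
  have hint' : Integrable (fun t => 24 * (Real.exp (1 * t) + Real.exp (-1 * t)))
      (gaussianReal 0 1) := ((hint 1).add (hint (-1))).const_mul 24
  calc ∫⁻ t, ENNReal.ofReal (t ^ 4) ∂(gaussianReal 0 1)
      ≤ ∫⁻ t, ENNReal.ofReal (24 * (Real.exp (1 * t) + Real.exp (-1 * t))) ∂(gaussianReal 0 1) := by
        refine lintegral_mono fun t => ENNReal.ofReal_le_ofReal ?_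
        have h1 := Real.pow_div_factorial_le_exp |t| (abs_nonneg t) 4
        have h2 : Real.exp |t| ≤ Real.exp (1 * t) + Real.exp (-1 * t) := by
          rcases abs_choice t with h | h
          · rw [h, one_mul]; linarith [Real.exp_pos (-1 * t)]
          · rw [h, neg_one_mul]; linarith [Real.exp_pos (1 * t)]
        have h3 : |t| ^ 4 = t ^ 4 := Even.pow_abs (by decide) t
        rw [h3, show (Nat.factorial 4 : ℝ) = 24 by norm_num [Nat.factorial]] at h1
        linarith
    _ = ENNReal.ofReal (24 * (Real.exp (1 ^ 2 / 2) + Real.exp ((-1) ^ 2 / 2))) := by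
        rw [← ofReal_integral_eq_lintegral_ofReal hint' (ae_of_all _ fun t => by positivity),
          integral_const_mul, integral_add (hint 1) (hint (-1)), hexp, hexp]
    _ ≤ 80 := by
        rw [show (80 : ℝ≥0∞) = ENNReal.ofReal 80 by simp]
        refine ENNReal.ofReal_le_ofReal ?_
        have h1 : Real.exp (1 / 2) ≤ 5 / 3 := by
          refine le_of_sq_le_sq ?_ (by norm_num)
          rw [← Real.exp_nat_mul]
          norm_num
          linarith [Real.exp_one_lt_d9]
        norm_num at h1 ⊢
        linarith

/-- On `[3/2, 2]`, of length `1/2`, the density is at least `1/3 · 1/8`. -/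
theorem le_gaussianReal_two_le_sq :
    ENNReal.ofReal (1 / 48) ≤ gaussianReal 0 1 {t : ℝ | 2 ≤ t ^ 2} := by
  calc ENNReal.ofReal (1 / 48) = ∫⁻ t in Set.Icc (3 / 2 : ℝ) 2, ENNReal.ofReal (1 / 24) := by
        rw [setLIntegral_const, Real.volume_Icc, ← ENNReal.ofReal_mul (by norm_num)]
        norm_num
    _ ≤ ∫⁻ t in Set.Icc (3 / 2 : ℝ) 2, gaussianPDF 0 1 t := by
        refine setLIntegral_mono (by fun_prop) fun t ht => ENNReal.ofReal_le_ofReal ?_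
        rw [gaussianPDFReal]
        have h1 : √(2 * Real.pi * ((1 : ℝ≥0) : ℝ)) ≤ 3 := by
          rw [Real.sqrt_le_left (by norm_num)]
          norm_num
          linarith [Real.pi_lt_d2]
        have h2 : 1 / 8 ≤ Real.exp (-(t - 0) ^ 2 / (2 * ((1 : ℝ≥0) : ℝ))) := by
          have h3 : Real.exp (-2) ≤ Real.exp (-(t - 0) ^ 2 / (2 * ((1 : ℝ≥0) : ℝ))) := by
            refine Real.exp_le_exp.2 ?_
            norm_num
            nlinarith [ht.1, ht.2]
          refine le_trans ?_ h3
          rw [Real.exp_neg, one_div]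
          refine inv_anti₀ (Real.exp_pos _) ?_
          have h4 : Real.exp 2 = Real.exp 1 ^ 2 := by rw [← Real.exp_nat_mul]; norm_num
          rw [h4]
          nlinarith [Real.exp_one_lt_d9, Real.exp_pos 1]
        have h5 : 1 / 3 ≤ (√(2 * Real.pi * ((1 : ℝ≥0) : ℝ)))⁻¹ := by
          rw [one_div]
          exact inv_anti₀ (Real.sqrt_pos.2 (by simp [Real.pi_pos])) h1
        calc (1 / 24 : ℝ) = 1 / 3 * (1 / 8) := by norm_num
          _ ≤ _ := by gcongr
    _ = gaussianReal 0 1 (Set.Icc (3 / 2) 2) := (gaussianReal_apply 0 one_ne_zero _).symm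
    _ ≤ _ := measure_mono fun t ht => by
        have := ht.1
        show 2 ≤ t ^ 2
        nlinarith

/-- Shrinking a Gaussian variable by the factor `1 + γ` lowers its density only little. -/
theorem gaussianReal_le_map_add {γ : ℝ} (hγ0 : 0 ≤ γ) (hγ1 : γ ≤ 1) {S : Set ℝ}
    (hS : MeasurableSet S) :
    gaussianReal 0 1 S ≤ gaussianReal 0 1 ((fun t => (1 + γ)⁻¹ * t) ⁻¹' S) +
      ∫⁻ t in S, ENNReal.ofReal (3 / 2 * γ * t ^ 2) ∂(gaussianReal 0 1) := by
  have hc : (0 : ℝ) < (1 + γ)⁻¹ := by positivity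
  set s : ℝ≥0 := ⟨(1 + γ)⁻¹ ^ 2, sq_nonneg _⟩ with hs
  have hs0 : s ≠ 0 := by
    intro h
    have : ((1 + γ)⁻¹) ^ 2 = (0 : ℝ) := congrArg NNReal.toReal h
    exact (pow_pos hc 2).ne' this
  have hmap := gaussianReal_map_const_mul (μ := 0) (v := 1) (1 + γ)⁻¹
  rw [mul_zero, mul_one] at hmap
  rw [← Measure.map_apply (by fun_prop) hS, hmap]
  change _ ≤ gaussianReal 0 s S + _
  rw [gaussianReal_apply _ one_ne_zero, gaussianReal_apply _ hs0,
    gaussianReal_of_var_ne_zero _ one_ne_zero,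
    setLIntegral_withDensity_eq_setLIntegral_mul _ (by fun_prop) (by fun_prop) hS,
    ← lintegral_add_left (by fun_prop)]
  refine lintegral_mono fun t => ?_
  simp only [Pi.mul_apply, gaussianPDF]
  rw [← ENNReal.ofReal_mul (gaussianPDFReal_nonneg _ _ _),
    ← ENNReal.ofReal_add (gaussianPDFReal_nonneg _ _ _)
      (mul_nonneg (gaussianPDFReal_nonneg _ _ _) (by positivity))]
  refine ENNReal.ofReal_le_ofReal ?_
  have hscoe : (s : ℝ) = (1 + γ)⁻¹ ^ 2 := rfl
  -- The density ratio is `(1 + γ) exp (-(γ + γ²/2) t²)`, at least `1 - (3/2) γ t²` when `0 ≤ γ ≤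
  -- 1`.
  have hpdf : gaussianPDFReal 0 s t =
      (1 + γ) * (gaussianPDFReal 0 1 t * Real.exp (-((2 * γ + γ ^ 2) / 2 * t ^ 2))) := by
    rw [gaussianPDFReal, gaussianPDFReal, hscoe, mul_assoc (_⁻¹) (Real.exp _), ← Real.exp_add,
      Real.sqrt_mul (by positivity), Real.sqrt_sq hc.le, mul_inv, inv_inv, NNReal.coe_one, mul_one]
    rw [show -(t - 0) ^ 2 / (2 * (1 + γ)⁻¹ ^ 2) =
      -(t - 0) ^ 2 / (2 * 1) + -((2 * γ + γ ^ 2) / 2 * t ^ 2) by field_simp; ring]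
    ring
  rw [hpdf]
  have h1 := Real.add_one_le_exp (-((2 * γ + γ ^ 2) / 2 * t ^ 2))
  have h2 := gaussianPDFReal_nonneg 0 1 t
  set φ := gaussianPDFReal 0 1 t
  have h3 : φ * (1 - 3 / 2 * γ * t ^ 2) ≤ φ * Real.exp (-((2 * γ + γ ^ 2) / 2 * t ^ 2)) := by
    gcongr
    have : (2 * γ + γ ^ 2) / 2 * t ^ 2 ≤ 3 / 2 * γ * t ^ 2 := by
      gcongr
      nlinarith
    linarith
  have h4 : 0 ≤ φ * Real.exp (-((2 * γ + γ ^ 2) / 2 * t ^ 2)) := by positivity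
  nlinarith

/-- The one-dimensional estimate on every slice, integrated over the other coordinates by Fubini. -/
theorem prod_gaussianReal_le_scale_add {Y : Type*} [MeasurableSpace Y] (ρ : Measure Y) [SFinite ρ]
    {γ : ℝ} (hγ0 : 0 ≤ γ) (hγ1 : γ ≤ 1) {D : Set (ℝ × Y)} (hD : MeasurableSet D) :
    ((gaussianReal 0 1).prod ρ) D ≤
      ((gaussianReal 0 1).prod ρ) ((fun z => ((1 + γ)⁻¹ * z.1, z.2)) ⁻¹' D) +
      ∫⁻ z in D, ENNReal.ofReal (3 / 2 * γ * z.1 ^ 2) ∂((gaussianReal 0 1).prod ρ) := by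
  have hD' : MeasurableSet ((fun z : ℝ × Y => ((1 + γ)⁻¹ * z.1, z.2)) ⁻¹' D) :=
    hD.preimage (by fun_prop)
  rw [Measure.prod_apply_symm hD, Measure.prod_apply_symm hD', ← lintegral_indicator hD,
    lintegral_prod_symm _ (by
      refine (Measurable.indicator ?_ hD).aemeasurable
      fun_prop), ← lintegral_add_left (measurable_measure_prodMk_right hD')]
  refine lintegral_mono fun y => ?_
  have hS : MeasurableSet ((fun x : ℝ => (x, y)) ⁻¹' D) := hD.preimage (by fun_prop)
  refine (gaussianReal_le_map_add hγ0 hγ1 hS).trans (le_of_eq ?_)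
  rw [← lintegral_indicator hS]
  rfl

theorem pi_gaussianReal_le_scale_add {k : ℕ} (j : Fin k) {γ : ℝ} (hγ0 : 0 ≤ γ) (hγ1 : γ ≤ 1)
    {D : Set (Fin k → ℝ)} (hD : MeasurableSet D) :
    Measure.pi (fun _ : Fin k => gaussianReal 0 1) D ≤
      Measure.pi (fun _ : Fin k => gaussianReal 0 1)
        ((fun x => Function.update x j ((1 + γ)⁻¹ * x j)) ⁻¹' D) +
      ∫⁻ x in D, ENNReal.ofReal (3 / 2 * γ * x j ^ 2)
        ∂(Measure.pi fun _ : Fin k => gaussianReal 0 1) := by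
  obtain ⟨k, rfl⟩ : ∃ m, k = m + 1 := ⟨k - 1, by have := j.pos; omega⟩
  have he := (measurePreserving_piFinSuccAbove (fun _ : Fin (k + 1) => gaussianReal 0 1) j).symm
  set e := (MeasurableEquiv.piFinSuccAbove (fun _ : Fin (k + 1) => ℝ) j).symm with hedef
  have heq : ∀ z : ℝ × (Fin k → ℝ), e z = Fin.insertNth (α := fun _ => ℝ) j z.1 z.2 :=
    fun z => rfl
  have hD' : MeasurableSet ((fun x : Fin (k + 1) → ℝ =>
      Function.update x j ((1 + γ)⁻¹ * x j)) ⁻¹' D) :=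
    hD.preimage (by fun_prop)
  rw [← he.measure_preimage hD.nullMeasurableSet, ← he.measure_preimage hD'.nullMeasurableSet,
    ← he.setLIntegral_comp_preimage hD (by fun_prop)]
  refine (prod_gaussianReal_le_scale_add _ hγ0 hγ1 (he.measurable hD)).trans (le_of_eq ?_)
  congr 1
  · congr 1
    ext z
    simp [heq]
  · simp [heq]

/-- The vectors whose largest entry is at `j` and has square at least `2`. -/
def maxAtSet {k : ℕ} (j : Fin k) : Set (Fin k → ℝ) :=
  {x | (∀ i, |x i| ≤ |x j|) ∧ 2 ≤ x j ^ 2}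

theorem measurableSet_maxAtSet {k : ℕ} (j : Fin k) : MeasurableSet (maxAtSet j) := by
  have h : maxAtSet j = (⋂ i, {x : Fin k → ℝ | |x i| ≤ |x j|}) ∩ {x | 2 ≤ x j ^ 2} := by
    ext; simp [maxAtSet]
  rw [h]
  exact (MeasurableSet.iInter fun i => measurableSet_le (by fun_prop) (by fun_prop)).inter
    (measurableSet_le (by fun_prop) (by fun_prop))

theorem pi_gaussianReal_maxAtSet_eq {k : ℕ} (i j : Fin k) :
    Measure.pi (fun _ : Fin k => gaussianReal 0 1) (maxAtSet i) =
      Measure.pi (fun _ : Fin k => gaussianReal 0 1) (maxAtSet j) := by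
  have h := measurePreserving_piCongrLeft (α := fun _ : Fin k => ℝ)
    (fun _ : Fin k => gaussianReal 0 1) (Equiv.swap i j)
  rw [← h.measure_preimage (measurableSet_maxAtSet i).nullMeasurableSet]
  congr 1
  ext x
  have hx : ∀ l, MeasurableEquiv.piCongrLeft (fun _ : Fin k => ℝ) (Equiv.swap i j) x l =
      x (Equiv.swap i j l) := fun l => by
    have := Equiv.piCongrLeft_apply_apply (P := fun _ : Fin k => ℝ) (Equiv.swap i j) x
      (Equiv.swap i j l)
    rwa [Equiv.swap_apply_self] at this
  simp only [maxAtSet, Set.mem_preimage, Set.mem_ofPred_eq, hx, Equiv.swap_apply_left]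
  refine and_congr_left fun _ => ⟨fun h l => ?_, fun h l => h _⟩
  simpa using h (Equiv.swap i j l)

/-- If one fixed coordinate has square at least `2`, so has the largest. The `k` possible positions
of the maximum are equally likely by symmetry. -/
theorem le_mul_pi_gaussianReal_maxAtSet {k : ℕ} (j : Fin k) :
    ENNReal.ofReal (1 / 48) ≤
      k * Measure.pi (fun _ : Fin k => gaussianReal 0 1) (maxAtSet j) := by
  have hev := measurePreserving_eval (fun _ : Fin k => gaussianReal 0 1) j
  have hmeas : MeasurableSet {t : ℝ | 2 ≤ t ^ 2} := measurableSet_le (by fun_prop) (by fun_prop)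
  refine le_gaussianReal_two_le_sq.trans ?_
  rw [← hev.measure_preimage hmeas.nullMeasurableSet]
  calc _ ≤ Measure.pi (fun _ : Fin k => gaussianReal 0 1) (⋃ i, maxAtSet i) := by
        refine measure_mono fun x hx => ?_
        have : Nonempty (Fin k) := ⟨j⟩
        obtain ⟨i, hi⟩ := Finite.exists_max fun i => |x i|
        refine Set.mem_iUnion.2 ⟨i, hi, ?_⟩
        have h1 : 2 ≤ x j ^ 2 := hx
        exact h1.trans (sq_le_sq.2 (hi j))
    _ ≤ ∑ i, Measure.pi (fun _ : Fin k => gaussianReal 0 1) (maxAtSet i) :=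
        measure_iUnion_fintype_le _ _
    _ = _ := by
        rw [Finset.sum_congr rfl fun i _ => pi_gaussianReal_maxAtSet_eq i j]
        simp

/-- The vectors whose entry at `j` exceeds all others by the factor `1 + γ`. -/
def gapAtSet {k : ℕ} (γ : ℝ) (j : Fin k) : Set (Fin k → ℝ) :=
  {x | (∀ i, i ≠ j → (1 + γ) * |x i| ≤ |x j|) ∧ 2 ≤ x j ^ 2}

/-- Shrinking coordinate `j` carries `maxAtSet` points to gap points, so it remains to bound the
loss, the integral of `(3/2) γ x_j²` over `maxAtSet j`. The size `1/√k` of `γ` allows a split of the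
integrand into a multiple of `x_j⁴ / k`, whose total integral is of order `1/k`, and a small
constant, which costs only a fraction of the probability of `maxAtSet j`. -/
theorem le_pi_gaussianReal_gapAtSet {k : ℕ} (j : Fin k) :
    ENNReal.ofReal (1 / (100 * k)) ≤
      Measure.pi (fun _ : Fin k => gaussianReal 0 1) (gapAtSet (1 / (1000 * √k)) j) := by
  have hk : (1 : ℝ) ≤ k := by exact_mod_cast j.pos
  have hsk : 1 ≤ √(k : ℝ) := Real.one_le_sqrt.2 hk
  have hsk2 : √(k : ℝ) * √k = k := Real.mul_self_sqrt (by linarith)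
  set μ := Measure.pi (fun _ : Fin k => gaussianReal 0 1) with hμ
  set γ : ℝ := 1 / (1000 * √k) with hγ
  have hγ0 : 0 < γ := by positivity
  have hγ1 : γ ≤ 1 := by rw [hγ, div_le_one (by positivity)]; linarith
  have h1 := pi_gaussianReal_le_scale_add j hγ0.le hγ1 (measurableSet_maxAtSet j)
  rw [← hμ] at h1
  have hsub : (fun x : Fin k → ℝ => Function.update x j ((1 + γ)⁻¹ * x j)) ⁻¹' maxAtSet j ⊆
      gapAtSet γ j := by
    rintro x ⟨h2, h3⟩
    simp only [Function.update_self] at h2 h3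
    have hc : 0 < (1 + γ)⁻¹ := by positivity
    refine ⟨fun i hi => ?_, ?_⟩
    · have := h2 i
      rw [Function.update_of_ne hi, abs_mul, abs_of_pos hc] at this
      rwa [← le_inv_mul_iff₀ (by positivity)]
    · refine h3.trans ?_
      rw [mul_pow]
      refine mul_le_of_le_one_left (sq_nonneg _) (pow_le_one₀ hc.le ?_)
      exact inv_le_one_of_one_le₀ (by linarith)
  have hev := measurePreserving_eval (fun _ : Fin k => gaussianReal 0 1) j
  have hfour : ∫⁻ x, ENNReal.ofReal (x j ^ 4) ∂μ ≤ 80 := by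
    have := hev.lintegral_comp (f := fun t : ℝ => ENNReal.ofReal (t ^ 4)) (by fun_prop)
    exact this.trans_le lintegral_pow_four_gaussianReal_le
  have hint : ∫⁻ x in maxAtSet j, ENNReal.ofReal (3 / 2 * γ * x j ^ 2) ∂μ ≤
      ENNReal.ofReal (3 / 40000 / k) * 80 + ENNReal.ofReal (3 / 400) * μ (maxAtSet j) := by
    calc _ ≤ ∫⁻ x in maxAtSet j, (ENNReal.ofReal (3 / 40000 / k) * ENNReal.ofReal (x j ^ 4) +
          ENNReal.ofReal (3 / 400)) ∂μ := by
          refine lintegral_mono fun x => ?_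
          rw [← ENNReal.ofReal_mul (by positivity), ← ENNReal.ofReal_add (by positivity)
            (by norm_num)]
          refine ENNReal.ofReal_le_ofReal ?_
          rw [hγ]
          -- This is `20 y ≤ y² + 100` for `y = x_j² / √k`.
          have h4 : x j ^ 2 / √k ≤ (x j ^ 4 / k + 100) / 20 := by
            have h5 : (x j ^ 2 / √(k : ℝ)) ^ 2 = x j ^ 4 / k := by
              rw [div_pow, sq (√(k : ℝ)), hsk2]; ring
            nlinarith [sq_nonneg (x j ^ 2 / √(k : ℝ) - 10)]
          calc 3 / 2 * (1 / (1000 * √(k : ℝ))) * x j ^ 2 = 3 / 2000 * (x j ^ 2 / √k) := by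
                field_simp; ring
            _ ≤ 3 / 2000 * ((x j ^ 4 / k + 100) / 20) := by gcongr
            _ = _ := by ring
      _ = ENNReal.ofReal (3 / 40000 / k) * (∫⁻ x in maxAtSet j, ENNReal.ofReal (x j ^ 4) ∂μ) +
          ENNReal.ofReal (3 / 400) * μ (maxAtSet j) := by
          rw [lintegral_add_right _ measurable_const, lintegral_const_mul _ (by fun_prop),
            setLIntegral_const]
      _ ≤ _ := by
          gcongr
          exact (setLIntegral_le_lintegral _ _).trans hfour
  have h2 : μ (maxAtSet j) ≤ μ (gapAtSet γ j) + (ENNReal.ofReal (3 / 40000 / k) * 80 +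
      ENNReal.ofReal (3 / 400) * μ (maxAtSet j)) :=
    h1.trans (add_le_add (measure_mono hsub) hint)
  have h3 := le_mul_pi_gaussianReal_maxAtSet j
  rw [← hμ] at h3
  rw [← ofReal_measureReal (measure_ne_top μ _)] at h2 h3 ⊢
  rw [← ofReal_measureReal (measure_ne_top μ (gapAtSet γ j))] at h2
  rw [show (80 : ℝ≥0∞) = ENNReal.ofReal 80 by simp, ← ENNReal.ofReal_mul (by positivity),
    ← ENNReal.ofReal_mul (by positivity), ← ENNReal.ofReal_add (by positivity) (by positivity),
    ← ENNReal.ofReal_add (by positivity) (by positivity),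
    ENNReal.ofReal_le_ofReal_iff (by positivity)] at h2
  rw [← ENNReal.ofReal_natCast, ← ENNReal.ofReal_mul (by positivity),
    ENNReal.ofReal_le_ofReal_iff (by positivity)] at h3
  refine ENNReal.ofReal_le_ofReal ?_
  set A := μ.real (maxAtSet j)
  set B := μ.real (gapAtSet γ j)
  rw [div_le_iff₀ (by positivity)]
  have h4 : 3 / 40000 / (k : ℝ) * k = 3 / 40000 := by field_simp
  nlinarith

/-- Markov's inequality: the sum of squares has mean `m`. -/
theorem half_le_pi_gaussianReal_sum_sq_le (m : ℕ) :
    ENNReal.ofReal (1 / 2) ≤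
      Measure.pi (fun _ : Fin m => gaussianReal 0 1) {y | ∑ i, y i ^ 2 ≤ 2 * m} := by
  rcases Nat.eq_zero_or_pos m with rfl | hm
  · have : {y : Fin 0 → ℝ | ∑ i, y i ^ 2 ≤ 2 * ((0 : ℕ) : ℝ)} = Set.univ := by ext; simp
    rw [this, measure_univ]
    exact ENNReal.ofReal_le_one.2 (by norm_num)
  set ρ := Measure.pi (fun _ : Fin m => gaussianReal 0 1) with hρ
  have hm' : (0 : ℝ) < m := by exact_mod_cast hm
  have hmeas : MeasurableSet {y : Fin m → ℝ | ∑ i, y i ^ 2 ≤ 2 * m} :=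
    measurableSet_le (by fun_prop) (by fun_prop)
  have hint : ∫⁻ y, ENNReal.ofReal (∑ i, y i ^ 2) ∂ρ = m := by
    simp_rw [ENNReal.ofReal_sum_of_nonneg fun i _ => sq_nonneg _]
    rw [lintegral_finsetSum _ fun i _ => by fun_prop]
    have : ∀ i, ∫⁻ y, ENNReal.ofReal (y i ^ 2) ∂ρ = 1 := fun i => by
      have hev := measurePreserving_eval (fun _ : Fin m => gaussianReal 0 1) i
      have := hev.lintegral_comp (f := fun t : ℝ => ENNReal.ofReal (t ^ 2)) (by fun_prop)
      exact this.trans lintegral_sq_gaussianReal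
    simp [this]
  have hmarkov := mul_meas_ge_le_lintegral (μ := ρ)
    (f := fun y : Fin m → ℝ => ENNReal.ofReal (∑ i, y i ^ 2)) (by fun_prop)
    (ENNReal.ofReal (2 * m))
  rw [hint] at hmarkov
  have hcompl : ρ {y : Fin m → ℝ | ∑ i, y i ^ 2 ≤ 2 * m}ᶜ ≤ ENNReal.ofReal (1 / 2) := by
    have hsub : {y : Fin m → ℝ | ∑ i, y i ^ 2 ≤ 2 * m}ᶜ ⊆
        {y | ENNReal.ofReal (2 * m) ≤ ENNReal.ofReal (∑ i, y i ^ 2)} := fun y hy =>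
      ENNReal.ofReal_le_ofReal (not_le.1 (by simpa using hy)).le
    have h1 := (mul_le_mul_right (measure_mono hsub) (ENNReal.ofReal (2 * m))).trans hmarkov
    rw [← ofReal_measureReal (measure_ne_top ρ _), ← ENNReal.ofReal_natCast,
      ← ENNReal.ofReal_mul (by positivity), ENNReal.ofReal_le_ofReal_iff (by positivity)] at h1
    rw [← ofReal_measureReal (measure_ne_top ρ _)]
    refine ENNReal.ofReal_le_ofReal ?_
    nlinarith
  rw [prob_compl_eq_one_sub hmeas] at hcompl
  have h1 : ρ {y : Fin m → ℝ | ∑ i, y i ^ 2 ≤ 2 * m} ≤ 1 := prob_le_one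
  rw [← ofReal_measureReal (measure_ne_top ρ _)] at hcompl h1 ⊢
  rw [← ENNReal.ofReal_one, ← ENNReal.ofReal_sub _ (by positivity),
    ENNReal.ofReal_le_ofReal_iff (by norm_num)] at hcompl
  exact ENNReal.ofReal_le_ofReal (by linarith)

end GaussianEstimates

/-! ### Probability that a Gaussian vector is a good start -/

namespace PTensor

variable {k n : ℕ}

theorem measurableSet_isGoodStart (v : Fin k → EuclideanSpace ℝ (Fin n)) (γ : ℝ) (j : Fin k) :
    MeasurableSet {u | IsGoodStart v γ j u} := by
  have h : {u | IsGoodStart v γ j u} = {u | inner ℝ (v j) u = 0}ᶜ ∩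
      ((⋂ i, ⋂ (_ : i ≠ j), {u | (1 + γ) * |inner ℝ (v i) u| ≤ |inner ℝ (v j) u|}) ∩
        {u | ‖u‖ ^ 2 ≤ n * inner ℝ (v j) u ^ 2}) := by
    ext; simp [IsGoodStart]
  rw [h]
  refine MeasurableSet.inter (measurableSet_eq_fun (by fun_prop) (by fun_prop)).compl
    (MeasurableSet.inter ?_ (measurableSet_le (by fun_prop) (by fun_prop)))
  exact MeasurableSet.iInter fun i => MeasurableSet.iInter fun _ =>
    measurableSet_le (by fun_prop) (by fun_prop)

/-- A standard Gaussian vector is a good starting vector for `v_j` with probability of order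
`1 / k`. -/
theorem le_stdGaussian_isGoodStart {v : Fin k → EuclideanSpace ℝ (Fin n)} (hv : Orthonormal ℝ v)
    (hkn : k ≤ n) (j : Fin k) :
    ENNReal.ofReal (1 / (200 * k)) ≤
      stdGaussian (EuclideanSpace ℝ (Fin n)) {u | IsGoodStart v (1 / (1000 * √k)) j u} := by
  obtain ⟨m, rfl⟩ := Nat.exists_eq_add_of_le hkn
  -- In a basis extending `v` the first `k` coordinates decide the gap and the other `n - k` matter
  -- only for the norm, so the two events are independent.
  obtain ⟨b, hb⟩ := Orthonormal.exists_orthonormalBasis_extension_of_card_eq (𝕜 := ℝ)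
    (ι := Fin k ⊕ Fin m) (E := EuclideanSpace ℝ (Fin (k + m))) (by simp)
    (v := Sum.elim v 0) (s := Set.range Sum.inl) (by
      rw [orthonormal_iff_ite]
      rintro ⟨_, i, rfl⟩ ⟨_, l, rfl⟩
      simpa [Subtype.ext_iff] using orthonormal_iff_ite.1 hv i l)
  have hbv : ∀ i, b (Sum.inl i) = v i := fun i => by
    simpa using hb (Sum.inl i) ⟨i, rfl⟩
  set γ : ℝ := 1 / (1000 * √k) with hγ
  have hinner : ∀ (x : Fin k ⊕ Fin m → ℝ) i, inner ℝ (v i) (∑ l, x l • b l) = x (Sum.inl i) :=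
    fun x i => by
      rw [← hbv, inner_sum]
      simp [inner_smul_right, orthonormal_iff_ite.1 b.orthonormal]
  have hnorm : ∀ x : Fin k ⊕ Fin m → ℝ, ‖∑ l, x l • b l‖ ^ 2 =
      ∑ i, x (Sum.inl i) ^ 2 + ∑ i, x (Sum.inr i) ^ 2 := fun x => by
    rw [← Fintype.sum_sum_type (fun l => x l ^ 2), ← real_inner_self_eq_norm_sq,
      b.orthonormal.inner_sum]
    simp [sq]
  have hmeasg := measurableSet_isGoodStart v γ j
  have hfun : Measurable fun x : Fin k ⊕ Fin m → ℝ => ∑ l, x l • b l := by fun_prop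
  rw [stdGaussian_eq_map_pi_orthonormalBasis b, Measure.map_apply hfun hmeasg]
  have he := measurePreserving_sumPiEquivProdPi_symm
    (fun _ : Fin k ⊕ Fin m => gaussianReal 0 1)
  rw [← he.measure_preimage (hmeasg.preimage hfun).nullMeasurableSet]
  have hsub : gapAtSet γ j ×ˢ {y : Fin m → ℝ | ∑ i, y i ^ 2 ≤ 2 * m} ⊆
      (MeasurableEquiv.sumPiEquivProdPi fun _ : Fin k ⊕ Fin m => ℝ).symm ⁻¹'
        ((fun x : Fin k ⊕ Fin m → ℝ => ∑ l, x l • b l) ⁻¹' {u | IsGoodStart v γ j u}) := by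
    rintro ⟨x, y⟩ ⟨⟨h1, h2⟩, h3⟩
    set z := (MeasurableEquiv.sumPiEquivProdPi fun _ : Fin k ⊕ Fin m => ℝ).symm (x, y) with hz
    have hzl : ∀ i, z (Sum.inl i) = x i := fun i => rfl
    have hzr : ∀ i, z (Sum.inr i) = y i := fun i => rfl
    change IsGoodStart v γ j (∑ l, z l • b l)
    have hγ0 : 0 ≤ γ := by positivity
    have h3' : ∑ i, y i ^ 2 ≤ 2 * (m : ℝ) := h3
    refine ⟨?_, fun i hi => ?_, ?_⟩
    · rw [hinner, hzl]
      rintro h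
      simp only [h] at h2
      norm_num at h2
    · rw [hinner, hinner, hzl, hzl]
      exact h1 i hi
    · rw [hnorm, hinner]
      simp only [hzl, hzr]
      have h4 : ∑ i, x i ^ 2 ≤ k * x j ^ 2 := by
        calc ∑ i, x i ^ 2 ≤ ∑ _i : Fin k, x j ^ 2 := by
              refine Finset.sum_le_sum fun i _ => sq_le_sq.2 ?_
              by_cases hi : i = j
              · rw [hi]
              · refine le_trans ?_ (h1 i hi)
                nlinarith [abs_nonneg (x i)]
          _ = _ := by simp
      -- The threshold `2 ≤ x_j²` was chosen to match the Markov bound `2m` here.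
      have h5 : 2 * (m : ℝ) ≤ x j ^ 2 * m := by gcongr
      push_cast
      linarith
  refine le_trans ?_ (measure_mono hsub)
  rw [Measure.prod_prod]
  calc ENNReal.ofReal (1 / (200 * k))
      = ENNReal.ofReal (1 / (100 * k)) * ENNReal.ofReal (1 / 2) := by
        rw [← ENNReal.ofReal_mul (by positivity)]
        congr 1
        rw [div_mul_div_comm]
        congr 1 <;> ring
    _ ≤ _ := mul_le_mul' (le_pi_gaussianReal_gapAtSet j) (half_le_pi_gaussianReal_sum_sq_le m)

end PTensor

/-! ### Union bound over rounds and components -/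

namespace PTensor

variable {k n L : ℕ}

theorem one_sub_pow_le_inv_pow (hk : 1 ≤ k) (hL : 1200 * (k * Real.log (k + 1)) ≤ L) :
    (1 - 1 / (200 * (k : ℝ))) ^ L ≤ ((k : ℝ) + 1)⁻¹ ^ 6 := by
  have hk' : (1 : ℝ) ≤ k := by exact_mod_cast hk
  have h0 : 0 ≤ 1 - 1 / (200 * (k : ℝ)) := by
    rw [sub_nonneg, div_le_one (by positivity)]; linarith
  calc (1 - 1 / (200 * (k : ℝ))) ^ L ≤ Real.exp (-(1 / (200 * (k : ℝ)))) ^ L := by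
        gcongr
        linarith [Real.add_one_le_exp (-(1 / (200 * (k : ℝ))))]
    _ = Real.exp (L * -(1 / (200 * (k : ℝ)))) := by rw [← Real.exp_nat_mul]
    _ ≤ Real.exp (6 * -Real.log (k + 1)) := by
        refine Real.exp_le_exp.2 ?_
        have : 6 * Real.log (k + 1) ≤ L * (1 / (200 * (k : ℝ))) := by
          rw [mul_one_div, le_div_iff₀ (by positivity)]
          linarith
        linarith
    _ = ((k : ℝ) + 1)⁻¹ ^ 6 := by
        rw [← Real.log_inv, ← Nat.cast_ofNat (R := ℝ) (n := 6), Real.exp_nat_mul,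
          Real.exp_log (by positivity)]

/-- With probability at least `9 / 10`, every round has a good starting vector for every
component. -/
theorem exists_event_isGoodStart {v : Fin k → EuclideanSpace ℝ (Fin n)} (hv : Orthonormal ℝ v)
    (hk : 1 ≤ k) (hkn : k ≤ n) (hL : 1200 * (k * Real.log (k + 1)) ≤ L)
    {Ω : Type*} [MeasurableSpace Ω] (P : Measure Ω) [IsProbabilityMeasure P]
    (g : Fin k → Fin L → Ω → EuclideanSpace ℝ (Fin n))
    (hg : ∀ r l, HasLaw (g r l) (stdGaussian (EuclideanSpace ℝ (Fin n))) P)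
    (hind : iIndepFun (fun (q : Fin k × Fin L) => g q.1 q.2) P) :
    ∃ G : Set Ω, MeasurableSet G ∧ 9 / 10 ≤ P G ∧
      ∀ ω ∈ G, ∀ r j, ∃ l, IsGoodStart v (1 / (1000 * √k)) j (g r l ω) := by
  have hk' : (1 : ℝ) ≤ k := by exact_mod_cast hk
  set γ : ℝ := 1 / (1000 * √k) with hγ
  set good : Fin k → Set (EuclideanSpace ℝ (Fin n)) := fun j => {u | IsGoodStart v γ j u}
    with hgood
  have hmeas : ∀ j, MeasurableSet (good j)ᶜ := fun j => (measurableSet_isGoodStart v γ j).compl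
  have hone : ∀ r l j, P (g r l ⁻¹' (good j)ᶜ) ≤ ENNReal.ofReal (1 - 1 / (200 * k)) := by
    intro r l j
    rw [← Measure.map_apply_of_aemeasurable (hg r l).aemeasurable (hmeas j), (hg r l).map_eq,
      prob_compl_eq_one_sub (measurableSet_isGoodStart v γ j), ENNReal.ofReal_sub _ (by positivity),
      ENNReal.ofReal_one]
    exact tsub_le_tsub_left (le_stdGaussian_isGoodStart hv hkn j) _
  set fail : Fin k → Fin k → Set Ω := fun r j => ⋂ l, g r l ⁻¹' (good j)ᶜ with hfail
  have hfailP : ∀ r j, P (fail r j) ≤ ENNReal.ofReal (((k : ℝ) + 1)⁻¹ ^ 6) := by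
    intro r j
    have h1 := hind.measure_inter_preimage_eq_mul (Finset.univ.map
      ⟨fun l : Fin L => (r, l), fun a b h => (Prod.mk.inj h).2⟩) (sets := fun _ => (good j)ᶜ)
      fun _ _ => hmeas j
    have h2 : fail r j = ⋂ q ∈ Finset.univ.map
        ⟨fun l : Fin L => (r, l), fun a b h => (Prod.mk.inj h).2⟩, g q.1 q.2 ⁻¹' (good j)ᶜ := by
      ext ω
      simp only [hfail, Set.mem_iInter, Finset.mem_map, Finset.mem_univ, true_and]
      exact ⟨by rintro h _ ⟨l, rfl⟩; exact h l, fun h l => h _ ⟨l, rfl⟩⟩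
    rw [h2, h1, Finset.prod_map]
    calc _ ≤ ∏ _l : Fin L, ENNReal.ofReal (1 - 1 / (200 * k)) :=
          Finset.prod_le_prod' fun l _ => hone r l j
      _ = ENNReal.ofReal ((1 - 1 / (200 * k)) ^ L) := by
          rw [Finset.prod_const, Finset.card_univ, Fintype.card_fin, ENNReal.ofReal_pow]
          rw [sub_nonneg, div_le_one (by positivity)]; linarith
      _ ≤ _ := ENNReal.ofReal_le_ofReal (one_sub_pow_le_inv_pow hk hL)
  set bad : Set Ω := ⋃ r, ⋃ j, fail r j with hbad
  have hbadP : P bad ≤ ENNReal.ofReal (1 / 16) := by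
    calc P bad ≤ ∑ r, ∑ j, P (fail r j) :=
          (measure_iUnion_fintype_le _ _).trans
            (Finset.sum_le_sum fun r _ => measure_iUnion_fintype_le _ _)
      _ ≤ ∑ _r : Fin k, ∑ _j : Fin k, ENNReal.ofReal (((k : ℝ) + 1)⁻¹ ^ 6) :=
          Finset.sum_le_sum fun r _ => Finset.sum_le_sum fun j _ => hfailP r j
      _ = ENNReal.ofReal (k * (k * ((k : ℝ) + 1)⁻¹ ^ 6)) := by
          simp [ENNReal.ofReal_mul]
      _ ≤ _ := by
          refine ENNReal.ofReal_le_ofReal ?_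
          have h1 : (k : ℝ) * ((k : ℝ) + 1)⁻¹ ≤ 1 := by
            rw [mul_inv_le_iff₀ (by positivity)]; linarith
          have h2 : ((k : ℝ) + 1)⁻¹ ≤ 1 / 2 := by
            rw [one_div]; exact inv_anti₀ (by norm_num) (by linarith)
          calc (k : ℝ) * (k * ((k : ℝ) + 1)⁻¹ ^ 6)
              = (k * ((k : ℝ) + 1)⁻¹) * (k * ((k : ℝ) + 1)⁻¹) * ((k : ℝ) + 1)⁻¹ ^ 4 := by ring
            _ ≤ 1 * 1 * (1 / 2) ^ 4 := by gcongr
            _ = 1 / 16 := by norm_num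
  -- `HasLaw` gives only a.e. measurability of the starts, so `bad` is enlarged to a measurable set
  -- of the same measure.
  refine ⟨(toMeasurable P bad)ᶜ, (measurableSet_toMeasurable P bad).compl, ?_, ?_⟩
  · rw [prob_compl_eq_one_sub (measurableSet_toMeasurable P bad), measure_toMeasurable]
    have h1 : (9 / 10 : ENNReal) = ENNReal.ofReal (9 / 10) := by
      rw [ENNReal.ofReal_div_of_pos (by norm_num)]; simp
    calc (9 / 10 : ENNReal) ≤ 1 - ENNReal.ofReal (1 / 16) := by
          rw [h1, ← ENNReal.ofReal_one, ← ENNReal.ofReal_sub _ (by norm_num)]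
          exact ENNReal.ofReal_le_ofReal (by norm_num)
      _ ≤ _ := tsub_le_tsub_left hbadP _
  · intro ω hω r j
    by_contra! h
    refine hω (subset_toMeasurable P bad (Set.mem_iUnion.2 ⟨r, Set.mem_iUnion.2 ⟨j, ?_⟩⟩))
    exact Set.mem_iInter.2 fun l => h l

/-- As `log (5/4) ≥ 1/5`, `20 log X` is twice what is needed; `log X ≥ 1` lets the surplus cover the
rounding in `T / 2`. -/
theorem le_five_fourths_pow {X : ℝ} (hX : 3 ≤ X) {T : ℕ} (hT : 20 * Real.log X ≤ T) :
    X ≤ (5 / 4) ^ (T / 2) := by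
  have hlogX : 1 ≤ Real.log X := by
    rw [Real.le_log_iff_exp_le (by linarith)]
    linarith [Real.exp_one_lt_d9]
  have h1 : (1 : ℝ) / 5 ≤ Real.log (5 / 4) := by
    have := Real.one_sub_inv_le_log_of_pos (show (0 : ℝ) < 5 / 4 by norm_num)
    norm_num at this ⊢
    linarith
  have h2 : (T : ℝ) ≤ 2 * (T / 2 : ℕ) + 1 := by
    have : T ≤ 2 * (T / 2) + 1 := by omega
    exact_mod_cast this
  rw [← Real.log_le_log_iff (by linarith) (by positivity), Real.log_pow]
  have h3 : ((T / 2 : ℕ) : ℝ) * (1 / 5) ≤ (T / 2 : ℕ) * Real.log (5 / 4) := by gcongr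
  linarith

end PTensor

/-! ### The main theorem -/

theorem mainTheorem2 :
    ∃ c CT CL : ℝ, 0 < c ∧ 0 < CT ∧ 0 < CL ∧
      ∀ (p k n T L : ℕ) (c₀ ε : ℝ) (lam : Fin k → ℝ) (v : Fin k → EuclideanSpace ℝ (Fin n))
        (E : PTensor p n) (iMax iMin : Fin k),
        3 ≤ p → 100 ≤ c₀ →
        (∀ i, 0 < lam i) → (∀ i, lam i ≤ lam iMax) → (∀ i, lam iMin ≤ lam i) →
        Orthonormal ℝ v →
        0 < ε →
        ε < c * lam iMin / (c₀ * (p : ℝ) ^ 2 * k * (n : ℝ) ^ (((p : ℝ) - 2) / 2)) →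
        PTensor.spectralNorm E ≤ ε / (c₀ * √(n : ℝ)) →
        CT * Real.log (lam iMax * n / ε) ≤ T →
        CL * (k * Real.log (k + 1)) ≤ L →
        ∀ {Ω : Type*} [MeasurableSpace Ω] (P : Measure Ω) [IsProbabilityMeasure P]
          (g : Fin k → Fin L → Ω → EuclideanSpace ℝ (Fin n)),
          (∀ r l, HasLaw (g r l) (stdGaussian (EuclideanSpace ℝ (Fin n))) P) →
          iIndepFun (fun (q : Fin k × Fin L) => g q.1 q.2) P →
          ∃ G : Set Ω, MeasurableSet G ∧ 9 / 10 ≤ P G ∧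
            ∀ ω ∈ G, ∀ (lamHat : Fin k → ℝ) (vHat : Fin k → EuclideanSpace ℝ (Fin n)),
              PTensor.IsDeflationOutput ((∑ i, lam i • PTensor.rankOne p (v i)) + E)
                (fun r l => g r l ω) T lamHat vHat →
              ∃ π : Equiv.Perm (Fin k), ∀ i,
                |lam i - lamHat (π i)| ≤ ε ∧
                (‖v i - vHat (π i)‖ ≤ ε / lam i ∨
                  (Even p ∧ ‖v i + vHat (π i)‖ ≤ ε / lam i)) := by
  -- With `c₀ ≥ 100`, `c = 1/1000` gives the factor `100000` in the smallness condition. `1200 = 200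
  -- · 6` makes each failure probability at most `(k + 1)⁻⁶`.
  refine ⟨1 / 1000, 20, 1200, by norm_num, by norm_num, by norm_num, ?_⟩
  intro p k n T L c₀ ε lam v E iMax iMin hp hc₀ hlam hmax hmin hv hε hsmall hE hT hL Ω _ P _ g hg
    hind
  obtain ⟨q, rfl⟩ : ∃ q, p = q + 1 := ⟨p - 1, by omega⟩
  have hq : 2 ≤ q := by omega
  have hk : 1 ≤ k := iMax.pos
  have hkn : k ≤ n := by simpa using hv.linearIndependent.fintype_card_le_finrank
  have hk1 : (1 : ℝ) ≤ k := by exact_mod_cast hk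
  have hn1 : (1 : ℝ) ≤ n := by exact_mod_cast hk.trans hkn
  have hsn : 1 ≤ √(n : ℝ) := Real.one_le_sqrt.2 hn1
  have hq0 : (2 : ℝ) ≤ q := by exact_mod_cast hq
  have hpow : (n : ℝ) ^ ((((q + 1 : ℕ) : ℝ) - 2) / 2) = √n ^ (q - 1) := by
    rw [Real.sqrt_eq_rpow, ← Real.rpow_natCast, ← Real.rpow_mul (by linarith)]
    congr 1
    push_cast [Nat.cast_sub (by omega : 1 ≤ q)]
    ring
  have hr1 : 1 ≤ √(n : ℝ) ^ (q - 1) := one_le_pow₀ hsn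
  have hsmall' : ∀ i, 100000 * ((q : ℝ) + 1) ^ 2 * k * √n ^ (q - 1) * ε ≤ lam i := fun i => by
    rw [hpow, lt_div_iff₀ (by positivity)] at hsmall
    push_cast at hsmall
    have h1 : 100 * ((q : ℝ) + 1) ^ 2 * k * √n ^ (q - 1) * ε ≤
        c₀ * ((q : ℝ) + 1) ^ 2 * k * √n ^ (q - 1) * ε := by gcongr
    linarith [hmin i]
  have hE' : ∀ u, ‖PTensor.contract E u‖ ≤ ε / (100 * √n) * ‖u‖ ^ q := fun u => by
    refine (PTensor.norm_contract_le (Nat.succ_pos q) E u).trans ?_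
    rw [Nat.succ_sub_one]
    gcongr
    exact hE.trans (by gcongr)
  -- Smallness of `ε` lets `log (lam_max n / ε)` dominate the logarithms of `p`, `k` and `n`, so one
  -- bound on `T` serves both runs.
  have hX : 100000 * ((q : ℝ) + 1) ^ 2 * k * n ≤ lam iMax * n / ε := by
    rw [le_div_iff₀ hε]
    calc 100000 * ((q : ℝ) + 1) ^ 2 * k * n * ε
        = 100000 * ((q : ℝ) + 1) ^ 2 * k * 1 * ε * n := by ring
      _ ≤ 100000 * ((q : ℝ) + 1) ^ 2 * k * √n ^ (q - 1) * ε * n := by gcongr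
      _ ≤ lam iMax * n := by gcongr; exact hsmall' iMax
  have hX3 : 3 ≤ lam iMax * n / ε := by
    refine le_trans ?_ hX
    calc (3 : ℝ) ≤ 100000 * 1 * 1 * 1 := by norm_num
      _ ≤ _ := by gcongr; nlinarith
  have hT2 := PTensor.le_five_fourths_pow hX3 hT
  obtain ⟨G, hG, hGP, hgood⟩ := PTensor.exists_event_isGoodStart hv hk hkn hL P g hg hind
  refine ⟨G, hG, hGP, fun ω hω lamHat vHat hout => ?_⟩
  refine hout.exists_perm hv hq hk hkn hε hlam hsmall' hE' (hX.trans hT2)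
    (fun i => le_trans ?_ hT2) (hgood ω hω)
  gcongr
  exact hmax i
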